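/- Let $\mu>0$, $\nu>0$, let $m\ge 3$ be an integer, and let $u_0:\mathbb R^3\to\mathbb R^3$ and $F_0:\mathbb R^3\to\mathbb R^{3\times 3}$ satisfy $(u_0,F_0)\in L^1(\mathbb R^3)\cap H^m(\mathbb R^3)$. Consider the Cauchy problem for the incompressible Oldroyd system with damping $$\begin{cases}\partial_t u-\mu\Delta u+u\cdot\nabla u+\nabla p=\sum_{i=1}^3 F_{\cdot i}\cdot\nabla F_{\cdot i},\\ \partial_t F_{\cdot j}+\nu F_{\cdot j}+u\cdot\nabla F_{\cdot j}=F_{\cdot j}\cdot\nabla u,\quad j=1,2,3,\\ \operatorname{div}u=0,\quad \operatorname{div}F^T=0,\end{cases}\qquad (u,F)(0,\cdot)=(u_0,F_0),$$ on $(0,\infty)\times\mathbb R^3$, where $F_{\cdot j}$ is the $j$-th column of $F$, $(a\cdot\nabla b)_k=\sum_l a_l\,\partial_l b_k$, and $\operatorname{div}F^T=0$ means that every column of $F$ is divergence free. A global strong solution is a pair $(u,F)\in C([0,\infty);H^m(\mathbb R^3))$ that attains the initial data, satisfies both divergence conditions for all $t\ge0$, and for every $t>0$ satisfies the two evolution equations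 almost everywhere in $x$ for some pressure $p$, with spatial derivatives taken in the weak sense and time derivatives in $L^2(\mathbb R^3)$. Then there is a constant $C>0$, depending only on $\mu,\nu,m,u_0,F_0$, such that every global strong solution $(u,F)$ with the initial data $(u_0,F_0)$ (in particular the unique small global solution that exists when $\|u_0\|_{H^m}+\|F_0\|_{H^m}\le\delta_0$ for a sufficiently small $\delta_0>0$) satisfies $$\|u(t)\|_{L^2}^2+\|F(t)\|_{L^2}^2\le C\,(t+1)^{-3/2}\qquad\text{for all } t\ge 0 .$$ -/

import Mathlib

open MeasureTheory TemperedDistribution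
open scoped SchwartzMap LineDeriv Laplacian

noncomputable section

namespace Oldroyd

/-- Three-dimensional Euclidean space. -/
abbrev E3 : Type := EuclideanSpace ℝ (Fin 3)

/-- Real-valued square-integrable functions on `ℝ³` (modulo equality almost everywhere). -/
abbrev L2 : Type := Lp ℝ 2 (volume : Measure E3)

/-- The standard unit vectors of `ℝ³`. -/
def e (i : Fin 3) : E3 := EuclideanSpace.single i (1 : ℝ)

/-- A real `L²` function, regarded as a complex-valued `L²` function. -/
def cplx (f : L2) : Lp ℂ 2 (volume : Measure E3) := Complex.ofRealCLM.compLp f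

/-- The tempered distribution `φ ↦ ∫ φ f` given by a real `L²` function `f`. Derivatives of `f` in
the sense of distributions are derivatives of `toDist f`. -/
def toDist (f : L2) : 𝓢'(E3, ℂ) := Lp.toTemperedDistribution (cplx f)

/-- `f` belongs to the Sobolev space `H^s(ℝ³)`. -/
def MemH (s : ℝ) (f : L2) : Prop := MemSobolev s 2 (toDist f)

/-- `f ∈ C([0,∞); H^s(ℝ³))`. The `H^s` norm is the `L²` norm of the Bessel potential of order `s`,
so this says that `t ↦ (1 - (2π)⁻² Δ)^(s/2) f(t)` is a continuous `L²`-valued map on `[0,∞)`. -/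
def ContinuousInH (s : ℝ) (f : ℝ → L2) : Prop :=
  ∃ G : ℝ → Lp ℂ 2 (volume : Measure E3), ContinuousOn G (Set.Ici 0) ∧
    ∀ t : ℝ, 0 ≤ t →
      besselPotential E3 ℂ s (toDist (f t)) = Lp.toTemperedDistribution (G t)

/-- `g = (∂₁f, ∂₂f, ∂₃f)` is the weak gradient of the distribution `f`. -/
def HasWeakGradient (f : 𝓢'(E3, ℂ)) (g : Fin 3 → L2) : Prop :=
  ∀ i : Fin 3, ∂_{e i} f = toDist (g i)

/-- The equations
`∂ₜu - μ Δu + u·∇u + ∇p = ∑ᵢ F_{·i}·∇F_{·i}` and `∂ₜF_{·j} + ν F_{·j} + u·∇F_{·j} = F_{·j}·∇u`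
hold at time `t`, almost everywhere in `x`, for some pressure `p`, where `F_{·j}` is the `j`-th
column of `F`. Time derivatives are limits of difference quotients in `L²`, spatial derivatives are
weak derivatives. Below, `Du k l = ∂_l u_k`, `Lu k = Δ u_k`, `DF k j l = ∂_l F_{kj}` and
`Dp k = ∂_k p`. -/
def SolvesAt (μ ν : ℝ) (u : ℝ → Fin 3 → L2) (F : ℝ → Fin 3 → Fin 3 → L2) (t : ℝ) : Prop :=
  ∃ (ut : Fin 3 → L2) (Du : Fin 3 → Fin 3 → L2) (Lu : Fin 3 → L2)
    (Ft : Fin 3 → Fin 3 → L2) (DF : Fin 3 → Fin 3 → Fin 3 → L2)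
    (p : 𝓢'(E3, ℂ)) (Dp : Fin 3 → L2),
    (∀ k, HasDerivAt (fun s => u s k) (ut k) t) ∧
    (∀ k j, HasDerivAt (fun s => F s k j) (Ft k j) t) ∧
    (∀ k, HasWeakGradient (toDist (u t k)) (Du k)) ∧
    (∀ k, Δ (toDist (u t k)) = toDist (Lu k)) ∧
    (∀ k j, HasWeakGradient (toDist (F t k j)) (DF k j)) ∧
    HasWeakGradient p Dp ∧
    (∀ k, ∀ᵐ x : E3,
      ut k x - μ * Lu k x + (∑ l, u t l x * Du k l x) + Dp k x
        = ∑ i, ∑ l, F t l i x * DF k i l x) ∧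
    (∀ k j, ∀ᵐ x : E3,
      Ft k j x + ν * F t k j x + (∑ l, u t l x * DF k j l x)
        = ∑ l, F t l j x * Du k l x)

/-- `(u, F)` is a global strong solution, in `C([0,∞); H^m(ℝ³))`, of the incompressible Oldroyd
system with viscosity `μ` and damping `ν` and with initial data `(u₀, F₀)`. -/
structure IsGlobalSolution (m : ℕ) (μ ν : ℝ) (u₀ : Fin 3 → L2) (F₀ : Fin 3 → Fin 3 → L2)
    (u : ℝ → Fin 3 → L2) (F : ℝ → Fin 3 → Fin 3 → L2) : Prop where
  continuous_u : ∀ k, ContinuousInH m (fun t => u t k)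
  continuous_F : ∀ k j, ContinuousInH m (fun t => F t k j)
  initial_u : u 0 = u₀
  initial_F : F 0 = F₀
  /-- `div u = 0` -/
  div_u : ∀ t : ℝ, 0 ≤ t → ∑ k, ∂_{e k} (toDist (u t k)) = 0
  /-- `div Fᵀ = 0`: every column of `F` is divergence free -/
  div_F : ∀ t : ℝ, 0 ≤ t → ∀ j, ∑ l, ∂_{e l} (toDist (F t l j)) = 0
  solves : ∀ t : ℝ, 0 < t → SolvesAt μ ν u F t

end Oldroyd

end

/-!
The proof is Schonbek's Fourier splitting method, run on the velocity alone because the deformation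
`F` is damped.

In the energy balance for `E = ‖u‖² + ‖F‖²` the pressure drops out and all transport terms cancel,
since `v·∇` is skew-symmetric for divergence-free `v` (`sum_inner_transport`); what remains is
viscous dissipation of `u` and damping of `F`. By Plancherel's theorem the viscous dissipation of the
frequencies above `r` is at least a multiple of `r²` times their energy, so for `κ r² ≤ 2ν`
`E' ≤ -κ r² E + κ r² ‖P_r u‖²`, where `P_r` is the low-pass filter `lowPass r`
(`SolvesAt.energy_hasDerivAt`).

The low frequencies are controlled without pointwise estimates of the Fourier transform. In the
derivative of `‖P_r u‖²` viscosity has a good sign, the pressure drops out, and in the quadratic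
terms the derivative falls on `P_r u`. By Bernstein's inequality (`bernstein`) `∇ P_r u` is bounded by a
multiple of `r^(5/2) ‖P_r u‖`, so `‖P_r u‖` grows at most at the rate `B r^(5/2) E`
(`SolvesAt.lowEnergy_hasDerivAt`). Initially `‖P_r u₀‖` is at most a multiple of
`r^(3/2) ‖u₀‖_{L¹}`, which is Bernstein's inequality in dual form (`norm_lowPass_le_of_integrable`).

With `r²` a multiple of `1/(t + T)` these facts give a differential inequality for `(t + T)² E`.
From `E ≤ E(0)` it yields `E = O(t^(-1/2))`, hence `∫₀ᵗ E = O(t^(1/2))`, and then, applied once more,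
`E = O(t^(-3/2))` (`fourier_splitting`).

All products that occur are square integrable because `H^m` embeds into `L^∞` (`MemH.essBdd`).
-/

namespace Oldroyd

open FourierTransform Filter Topology
open scoped ContDiff InnerProductSpace ComplexConjugate

/-- Complex-valued square-integrable functions on `ℝ³`. -/
abbrev L2C : Type := Lp ℂ 2 (volume : Measure E3)

/-! ### Weak derivatives on the Fourier side -/

theorem integrable_schwartz_mul (φ : 𝓢(E3, ℂ)) (f : L2C) :
    Integrable (fun x => φ x * f x) :=
  (φ.memLp 2).integrable_mul (Lp.memLp f)

/-- An identity between products of `L²` functions with symbols of temperate growth holds as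
tempered distributions exactly when it holds almost everywhere. -/
theorem sum_smulLeftCLM_eq_zero_iff {ι : Type*} [Fintype ι] {p : ι → E3 → ℂ}
    (hp : ∀ i, (p i).HasTemperateGrowth) (f : ι → L2C) :
    ∑ i, smulLeftCLM ℂ (p i) (f i : 𝓢'(E3, ℂ)) = 0 ↔ ∀ᵐ x, ∑ i, p i x * f i x = 0 := by
  have key : ∀ φ : 𝓢(E3, ℂ), (∑ i, smulLeftCLM ℂ (p i) (f i : 𝓢'(E3, ℂ))) φ
      = ∫ x, φ x * ∑ i, p i x * f i x := by
    intro φ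
    have h1 : ∀ i, smulLeftCLM ℂ (p i) (f i : 𝓢'(E3, ℂ)) φ
        = ∫ x, (SchwartzMap.smulLeftCLM ℂ (p i) φ) x * f i x := by
      intro i; simp
    rw [sum_apply]
    simp_rw [h1]
    rw [← integral_finsetSum _ (fun i _ => integrable_schwartz_mul _ _)]
    congr 1; ext x
    rw [Finset.mul_sum]
    refine Finset.sum_congr rfl fun i _ => ?_
    rw [SchwartzMap.smulLeftCLM_apply_apply (hp i)]
    simp only [smul_eq_mul]; ring
  constructor
  · intro h
    apply ae_eq_zero_of_integral_contDiff_smul_eq_zero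
    · refine locallyIntegrable_finsetSum _ fun i _ => ?_
      rw [← locallyIntegrableOn_univ]
      refine LocallyIntegrableOn.continuousOn_mul ?_ (hp i).1.continuous.continuousOn
        isOpen_univ.isLocallyClosed
      rw [locallyIntegrableOn_univ]
      exact (Lp.memLp (f i)).locallyIntegrable (by norm_num)
    · intro g hg hgc
      have hg₁ : HasCompactSupport (Complex.ofRealCLM ∘ g) := hgc.comp_left rfl
      have hg₂ : ContDiff ℝ ∞ (Complex.ofRealCLM ∘ g) := by fun_prop
      have := key (hg₁.toSchwartzMap hg₂)
      rw [h] at this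
      simpa using this.symm
  · intro h
    ext φ
    rw [key φ, integral_eq_zero_of_ae]
    · simp
    · filter_upwards [h] with x hx
      simp [hx]

theorem toTemperedDistribution_eq_smulLeftCLM_iff {p : E3 → ℂ} (hp : p.HasTemperateGrowth)
    (f g : L2C) : smulLeftCLM ℂ p (f : 𝓢'(E3, ℂ)) = g ↔ ∀ᵐ x, g x = p x * f x := by
  have := sum_smulLeftCLM_eq_zero_iff (p := ![p, fun _ => -1])
    (by intro i; fin_cases i <;> simp [hp]) ![f, g]
  simp only [Fin.sum_univ_two, Matrix.cons_val_zero, Matrix.cons_val_one,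
    TemperedDistribution.smulLeftCLM_const] at this
  have hneg : (-1 : ℂ) • (g : 𝓢'(E3, ℂ)) = -(g : 𝓢'(E3, ℂ)) := by ext; simp
  rw [hneg] at this
  rw [← sub_eq_zero, sub_eq_add_neg, this]
  refine eventually_congr (Eventually.of_forall fun x => ?_)
  constructor <;> intro h <;> linear_combination (-1 : ℂ) * h

theorem inner_e (x : E3) (l : Fin 3) : inner ℝ x (e l) = x l := by
  simp [e, EuclideanSpace.inner_single_right]

/-- The symbol `2πi ξ_l` of `∂_l`. -/
noncomputable def derivSymbol (l : Fin 3) (ξ : E3) : ℂ := 2 * Real.pi * Complex.I * (ξ l : ℂ)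

theorem derivSymbol_temperate (l : Fin 3) : (derivSymbol l).HasTemperateGrowth := by
  have : derivSymbol l = fun ξ : E3 => 2 * Real.pi * Complex.I * ((inner ℝ ξ (e l) : ℝ) : ℂ) := by
    ext ξ; rw [inner_e]; rfl
  rw [this]; fun_prop

theorem fourier_lineDeriv_e (f : 𝓢'(E3, ℂ)) (l : Fin 3) :
    𝓕 (∂_{e l} f) = smulLeftCLM ℂ (derivSymbol l) (𝓕 f) := by
  have h : derivSymbol l =
      (2 * Real.pi * Complex.I : ℂ) • fun ξ : E3 => ((inner ℝ ξ (e l) : ℝ) : ℂ) := by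
    ext ξ; simp only [Pi.smul_apply]; rw [inner_e]; rfl
  rw [TemperedDistribution.fourier_lineDerivOp_eq, h,
    TemperedDistribution.smulLeftCLM_smul (by fun_prop)]
  rfl

theorem fourier_injective {f g : 𝓢'(E3, ℂ)} (h : 𝓕 f = 𝓕 g) : f = g := by
  rw [← FourierTransform.fourierInv_fourier_eq (F := 𝓢'(E3, ℂ)) f, h,
    FourierTransform.fourierInv_fourier_eq]

/-- Weak differentiation of `L²` functions is multiplication by `derivSymbol` on the Fourier
side. -/
theorem lineDeriv_eq_iff (f g : L2C) (l : Fin 3) :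
    ∂_{e l} (f : 𝓢'(E3, ℂ)) = g ↔ ∀ᵐ ξ, (𝓕 g : L2C) ξ = derivSymbol l ξ * (𝓕 f : L2C) ξ := by
  rw [← toTemperedDistribution_eq_smulLeftCLM_iff (derivSymbol_temperate l),
    ← Lp.fourier_toTemperedDistribution_eq, ← Lp.fourier_toTemperedDistribution_eq,
    ← fourier_lineDeriv_e]
  exact ⟨fun h => by rw [h], fourier_injective⟩

theorem fourier_laplacian_ae {f g : L2C} (h : Δ (f : 𝓢'(E3, ℂ)) = g) :
    ∀ᵐ ξ, (𝓕 g : L2C) ξ = -(((2 * Real.pi) ^ 2 * ‖ξ‖ ^ 2 : ℝ) : ℂ) * (𝓕 f : L2C) ξ := by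
  have hs : (fun x : E3 => Complex.ofReal (‖x‖ ^ 2)).HasTemperateGrowth := by fun_prop
  have hs' : (fun ξ : E3 => -(((2 * Real.pi) ^ 2 * ‖ξ‖ ^ 2 : ℝ) : ℂ)).HasTemperateGrowth := by
    fun_prop
  rw [← toTemperedDistribution_eq_smulLeftCLM_iff hs',
    ← Lp.fourier_toTemperedDistribution_eq, ← Lp.fourier_toTemperedDistribution_eq, ← h,
    TemperedDistribution.laplacian_eq_fourierMultiplierCLM, fourierMultiplierCLM_apply]
  have : (fun ξ : E3 => -(((2 * Real.pi) ^ 2 * ‖ξ‖ ^ 2 : ℝ) : ℂ))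
      = (-((2 * Real.pi : ℝ) : ℂ) ^ 2) • fun x : E3 => Complex.ofReal (‖x‖ ^ 2) := by
    ext ξ; simp
  rw [this, TemperedDistribution.smulLeftCLM_smul hs, ← Complex.coe_smul,
    FourierTransform.fourier_smul,
    FourierTransform.fourier_fourierInv_eq]
  simp

/-- A divergence-free field is pointwise orthogonal to the frequency on the Fourier side. -/
theorem fourier_div_ae {f : Fin 3 → L2C} (h : ∑ l, ∂_{e l} (f l : 𝓢'(E3, ℂ)) = 0) :
    ∀ᵐ ξ, ∑ l, derivSymbol l ξ * (𝓕 (f l) : L2C) ξ = 0 := by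
  rw [← sum_smulLeftCLM_eq_zero_iff derivSymbol_temperate]
  simp_rw [← Lp.fourier_toTemperedDistribution_eq, ← fourier_lineDeriv_e]
  have : 𝓕 (∑ l, ∂_{e l} (f l : 𝓢'(E3, ℂ))) = 0 := by
    rw [h]; exact map_zero (fourierCLM ℂ 𝓢'(E3, ℂ))
  rw [← this]
  exact (map_sum (fourierCLM ℂ 𝓢'(E3, ℂ)) _ _).symm

/-- A gradient is curl free on the Fourier side, even if its potential is only a distribution. -/
theorem fourier_gradient_ae {p : 𝓢'(E3, ℂ)} {g : Fin 3 → L2C}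
    (h : ∀ l, ∂_{e l} p = g l) (j k : Fin 3) :
    ∀ᵐ ξ, derivSymbol j ξ * (𝓕 (g k) : L2C) ξ = derivSymbol k ξ * (𝓕 (g j) : L2C) ξ := by
  have key : ∀ j k : Fin 3, smulLeftCLM ℂ (derivSymbol j) (Lp.toTemperedDistribution (𝓕 (g k)))
      = smulLeftCLM ℂ (derivSymbol k * derivSymbol j) (𝓕 p) := by
    intro j k
    rw [← Lp.fourier_toTemperedDistribution_eq, ← h, fourier_lineDeriv_e,
      TemperedDistribution.smulLeftCLM_smulLeftCLM_apply (derivSymbol_temperate k)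
        (derivSymbol_temperate j)]
  have := sum_smulLeftCLM_eq_zero_iff (p := ![derivSymbol j, -derivSymbol k])
    (by intro i; fin_cases i
        · exact derivSymbol_temperate j
        · exact (derivSymbol_temperate k).neg) ![𝓕 (g k), 𝓕 (g j)]
  simp only [Fin.sum_univ_two, Matrix.cons_val_zero, Matrix.cons_val_one] at this
  rw [TemperedDistribution.smulLeftCLM_neg (derivSymbol_temperate k)] at this
  have h0 := this.1 (by
    rw [neg_apply, key, key, mul_comm]; simp)
  filter_upwards [h0] with ξ hξ
  simp only [Pi.neg_apply] at hξ
  linear_combination hξ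

/-- An `L²` function whose Fourier transform is integrable is essentially bounded by the `L¹` norm
of that transform. -/
theorem ae_norm_le_of_integrable_fourier (f : L2C) (hf : Integrable (𝓕 f : L2C)) :
    ∀ᵐ x, ‖f x‖ ≤ ∫ ξ, ‖(𝓕 f : L2C) ξ‖ := by
  set F : E3 → ℂ := ((𝓕 f : L2C) : E3 → ℂ) with hF
  have hcont : Continuous (𝓕⁻ F) := by
    exact VectorFourier.fourierIntegral_continuous Real.continuous_fourierChar
      (L := -innerₗ E3) (by simpa using! continuous_inner.neg) hf
  have heq : ∀ᵐ x, f x = 𝓕⁻ F x := by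
    apply ae_eq_of_integral_contDiff_smul_eq
    · exact (Lp.memLp f).locallyIntegrable (by norm_num)
    · exact hcont.locallyIntegrable
    · intro g hg hgc
      have hg₁ : HasCompactSupport (Complex.ofRealCLM ∘ g) := hgc.comp_left rfl
      have hg₂ : ContDiff ℝ ∞ (Complex.ofRealCLM ∘ g) := by fun_prop
      set φ := hg₁.toSchwartzMap hg₂ with hφ
      have h1 : Lp.toTemperedDistribution (𝓕 f) (𝓕⁻ φ) = Lp.toTemperedDistribution f φ := by
        rw [← Lp.fourier_toTemperedDistribution_eq, TemperedDistribution.fourier_apply,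
          FourierTransform.fourier_fourierInv_eq]
      have h2 : ∫ ξ, 𝓕⁻ (φ : E3 → ℂ) ξ • F ξ = ∫ x, φ x • 𝓕⁻ F x := by
        have := VectorFourier.integral_fourierIntegral_smul_eq_flip (L := -innerₗ E3)
          (μ := volume) (ν := volume)
          Real.continuous_fourierChar (by simpa using! continuous_inner.neg) φ.integrable hf
        have hflip : (-innerₗ E3).flip = -innerₗ E3 := by
          ext x y; simp [real_inner_comm]
        rw [hflip] at this
        exact this
      rw [Lp.toTemperedDistribution_apply, Lp.toTemperedDistribution_apply] at h1
      rw [← SchwartzMap.fourierInv_coe] at h2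
      rw [h2] at h1
      simpa [hφ] using h1.symm
  filter_upwards [heq] with x hx
  rw [hx, Real.fourierInv_eq]
  refine (norm_integral_le_integral_norm _).trans (le_of_eq ?_)
  simp [Circle.norm_smul]

/-! ### Real functions as complex functions -/

theorem coeFn_cplx (f : L2) : ∀ᵐ x, cplx f x = ((f x : ℝ) : ℂ) :=
  Complex.ofRealCLM.coeFn_compLp f

theorem cplx_sub (f g : L2) : cplx (f - g) = cplx f - cplx g :=
  map_sub (Complex.ofRealCLM.compLpL 2 (volume : Measure E3)) f g

/-- `cplx` as a continuous `ℝ`-linear map. -/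
noncomputable def cplxL : L2 →L[ℝ] L2C := Complex.ofRealCLM.compLpL 2 (volume : Measure E3)

theorem cplxL_apply (f : L2) : cplxL f = cplx f := rfl

theorem inner_eq_integral_mul (f : L2) (g : L2C) : ⟪cplx f, g⟫_ℂ = ∫ x, (f x : ℂ) * g x := by
  rw [L2.inner_def]
  refine integral_congr_ae ?_
  filter_upwards [coeFn_cplx f] with x hx
  rw [hx]; simp [mul_comm]

theorem inner_cplx (f g : L2) : ⟪cplx f, cplx g⟫_ℂ = ((⟪f, g⟫_ℝ : ℝ) : ℂ) := by
  rw [inner_eq_integral_mul, L2.inner_def]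
  refine Eq.trans ?_ (integral_ofReal (𝕜 := ℂ))
  refine integral_congr_ae ?_
  filter_upwards [coeFn_cplx g] with x hx
  rw [hx]; simp [mul_comm]

theorem norm_cplx (f : L2) : ‖cplx f‖ = ‖f‖ := by
  have h := inner_cplx f f
  rw [inner_self_eq_norm_sq_to_K, real_inner_self_eq_norm_sq] at h
  have h2 : ‖cplx f‖ ^ 2 = ‖f‖ ^ 2 := by
    apply Complex.ofReal_injective
    simpa using h
  exact (pow_left_inj₀ (norm_nonneg _) (norm_nonneg _) two_ne_zero).1 h2

/-! ### Sobolev embedding and Bernstein's inequality -/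

theorem fourier_ae_of_besselPotential {s : ℝ} {f G : L2C}
    (h : besselPotential E3 ℂ s (f : 𝓢'(E3, ℂ)) = G) :
    ∀ᵐ ξ, (𝓕 G : L2C) ξ = (((1 + ‖ξ‖ ^ 2) ^ (s / 2) : ℝ) : ℂ) * (𝓕 f : L2C) ξ := by
  rw [← toTemperedDistribution_eq_smulLeftCLM_iff (by fun_prop),
    ← Lp.fourier_toTemperedDistribution_eq, ← Lp.fourier_toTemperedDistribution_eq, ← h,
    fourier_besselPotential_eq_smulLeftCLM_fourier_apply]

/-- The `H^s` norm dominates the `L²` norm. -/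
theorem norm_le_of_besselPotential {s : ℝ} (hs : 0 ≤ s) {f G : L2C}
    (h : besselPotential E3 ℂ s (f : 𝓢'(E3, ℂ)) = G) : ‖f‖ ≤ ‖G‖ := by
  rw [← Lp.norm_fourier_eq f, ← Lp.norm_fourier_eq G]
  refine Lp.norm_le_norm_of_ae_le ?_
  filter_upwards [fourier_ae_of_besselPotential h] with ξ hξ
  rw [hξ, norm_mul, Complex.norm_real, Real.norm_eq_abs]
  refine le_mul_of_one_le_left (norm_nonneg _) (le_trans ?_ (le_abs_self _))
  exact Real.one_le_rpow (by nlinarith [sq_nonneg ‖ξ‖]) (by positivity)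

theorem ContinuousInH.memH {s : ℝ} {f : ℝ → L2} (hf : ContinuousInH s f) {t : ℝ} (ht : 0 ≤ t) :
    MemH s (f t) := by
  obtain ⟨G, -, hG⟩ := hf
  exact ⟨G t, hG t ht⟩

theorem ContinuousInH.continuousOn {s : ℝ} (hs : 0 ≤ s) {f : ℝ → L2} (hf : ContinuousInH s f) :
    ContinuousOn f (Set.Ici 0) := by
  obtain ⟨G, hGc, hG⟩ := hf
  intro t ht
  rw [ContinuousWithinAt, tendsto_iff_norm_sub_tendsto_zero]
  have h := tendsto_iff_norm_sub_tendsto_zero.1 (hGc t ht)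
  refine squeeze_zero' (Eventually.of_forall fun _ => norm_nonneg _) ?_ h
  filter_upwards [self_mem_nhdsWithin] with r hr
  rw [← norm_cplx, cplx_sub]
  refine norm_le_of_besselPotential hs ?_
  have e1 : ∀ a b : L2C, Lp.toTemperedDistribution (a - b)
      = (Lp.toTemperedDistribution a - Lp.toTemperedDistribution b : 𝓢'(E3, ℂ)) :=
    fun a b => map_sub (Lp.toTemperedDistributionCLM ℂ (volume : Measure E3) 2) a b
  rw [e1, e1, map_sub, ← hG t ht, ← hG r hr]
  rfl

/-- An essentially bounded function. -/
def EssBdd {𝕜 : Type*} [Norm 𝕜] (f : E3 → 𝕜) : Prop := ∃ M : ℝ, ∀ᵐ x, ‖f x‖ ≤ M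

/-- The Sobolev embedding `H^m(ℝ³) ⊆ L^∞(ℝ³)` for `m ≥ 3`. -/
theorem MemH.essBdd {m : ℕ} (hm : 3 ≤ m) {f : L2} (hf : MemH m f) : EssBdd f := by
  have hs : (Module.finrank ℝ E3 : ℝ) < 2 * (m : ℝ) := by
    have : (3 : ℝ) ≤ m := by exact_mod_cast hm
    simp only [finrank_euclideanSpace, Fintype.card_fin]; push_cast; linarith
  obtain ⟨v, hv⟩ := MemSobolev.fourier_memL1 hs hf
  have heq : ∀ᵐ ξ, (𝓕 (cplx f) : L2C) ξ = v ξ := by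
    apply ae_eq_of_integral_contDiff_smul_eq
    · exact (Lp.memLp _).locallyIntegrable (by norm_num)
    · exact (Lp.memLp v).locallyIntegrable le_rfl
    · intro g hg hgc
      have hg₁ : HasCompactSupport (Complex.ofRealCLM ∘ g) := hgc.comp_left rfl
      have hg₂ : ContDiff ℝ ∞ (Complex.ofRealCLM ∘ g) := by fun_prop
      have h2 : Lp.toTemperedDistribution (𝓕 (cplx f)) (hg₁.toSchwartzMap hg₂)
          = Lp.toTemperedDistribution v (hg₁.toSchwartzMap hg₂) := by
        rw [← hv, ← Lp.fourier_toTemperedDistribution_eq]; rfl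
      rw [Lp.toTemperedDistribution_apply, Lp.toTemperedDistribution_apply] at h2
      simpa using h2
  have hint : Integrable (𝓕 (cplx f) : L2C) :=
    (memLp_one_iff_integrable.1 (Lp.memLp v)).congr (Filter.EventuallyEq.symm heq)
  refine ⟨∫ ξ, ‖(𝓕 (cplx f) : L2C) ξ‖, ?_⟩
  filter_upwards [ae_norm_le_of_integrable_fourier _ hint, coeFn_cplx f] with x h1 h2
  rw [h2, Complex.norm_real] at h1
  exact h1

/-- The Cauchy–Schwarz inequality for a product of a weight with an `L²` function. -/
theorem integrable_of_ae_eq_mul {F G : L2C} {w : E3 → ℂ} (hw : MemLp w 2)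
    (h : ∀ᵐ x, F x = w x * G x) :
    Integrable F ∧ ∫ x, ‖F x‖ ≤ ‖hw.toLp w‖ * ‖G‖ := by
  have hae : ((hw.toLp w • G : Lp ℂ 1 (volume : Measure E3)) : E3 → ℂ) =ᵐ[volume] F := by
    filter_upwards [Lp.coeFn_lpSMul (r := 1) (hw.toLp w) G, hw.coeFn_toLp, h] with x h1 h2 h3
    rw [h1, h3, Pi.smul_apply', h2, smul_eq_mul]
  refine ⟨(memLp_one_iff_integrable.1 (Lp.memLp _)).congr hae, ?_⟩
  refine le_trans (le_of_eq ?_) (Lp.norm_smul_le (r := 1) (hw.toLp w) G)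
  rw [L1.norm_eq_integral_norm]
  refine integral_congr_ae ?_
  filter_upwards [hae] with x hx
  rw [hx]

/-- The constant of Bernstein's inequality, the square root of the volume of the unit ball. -/
noncomputable def bernsteinConst : ℝ := √((volume : Measure E3).real (Metric.ball 0 1))

/-- Bernstein's inequality: an `L²` function with frequencies below `r` is bounded by
`c r^(3/2)` times its `L²` norm. -/
theorem bernstein {r : ℝ} (hr : 0 ≤ r) {g : L2C} (hg : ∀ᵐ ξ, r ≤ ‖ξ‖ → (𝓕 g : L2C) ξ = 0) :
    ∀ᵐ x, ‖g x‖ ≤ bernsteinConst * √r ^ 3 * ‖g‖ := by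
  have hfin : (volume : Measure E3) (Metric.ball 0 r) ≠ ⊤ := measure_ball_lt_top.ne
  have hw : MemLp ((Metric.ball (0 : E3) r).indicator fun _ => (1 : ℂ)) 2 :=
    memLp_indicator_const 2 measurableSet_ball 1 (Or.inr hfin)
  obtain ⟨h1, h2⟩ := integrable_of_ae_eq_mul (F := 𝓕 g) (G := 𝓕 g) hw (by
    filter_upwards [hg] with ξ hξ
    by_cases h : r ≤ ‖ξ‖
    · simp [hξ h]
    · rw [Set.indicator_of_mem (by simpa using h), one_mul])
  have h3 : ‖hw.toLp _‖ = bernsteinConst * √r ^ 3 := by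
    have := norm_indicatorConstLp (p := 2) (c := (1 : ℂ))
      (hs := measurableSet_ball (x := (0 : E3)) (ε := r)) (hμs := hfin) two_ne_zero (by simp)
    rw [indicatorConstLp] at this
    rw [this, Measure.real, Measure.addHaar_ball _ _ hr, ENNReal.toReal_mul,
      ENNReal.toReal_ofReal (by positivity)]
    simp only [norm_one, one_mul, finrank_euclideanSpace, Fintype.card_fin, ENNReal.toReal_ofNat,
      bernsteinConst, Measure.real]
    rw [← Real.sqrt_eq_rpow, Real.sqrt_mul (by positivity), mul_comm]
    congr 1
    rw [Real.sqrt_eq_iff_mul_self_eq (by positivity) (by positivity)]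
    calc r ^ 3 = (√r ^ 2) ^ 3 := by rw [Real.sq_sqrt hr]
      _ = √r ^ 3 * √r ^ 3 := by ring
  rw [h3, Lp.norm_fourier_eq] at h2
  filter_upwards [ae_norm_le_of_integrable_fourier g h1] with x hx
  exact hx.trans h2

/-! ### The low-pass filter -/

/-- The Fourier multiplier with a bounded symbol `σ`, as an operator on `L²`. -/
noncomputable def multiplier (σ : E3 → ℂ) (hσ : MemLp σ ⊤ (volume : Measure E3)) : L2C →L[ℂ] L2C :=
  ((Lp.fourierTransformₗᵢ E3 ℂ).symm.toContinuousLinearEquiv : L2C →L[ℂ] L2C) ∘L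
    ((ContinuousLinearMap.mul ℂ ℂ).holderL volume ⊤ 2 2 (hσ.toLp σ)) ∘L
    ((Lp.fourierTransformₗᵢ E3 ℂ).toContinuousLinearEquiv : L2C →L[ℂ] L2C)

theorem fourier_multiplier_ae {σ : E3 → ℂ} (hσ : MemLp σ ⊤ (volume : Measure E3)) (f : L2C) :
    ∀ᵐ ξ, (𝓕 (multiplier σ hσ f) : L2C) ξ = σ ξ * (𝓕 f : L2C) ξ := by
  have h : (𝓕 (multiplier σ hσ f) : L2C)
      = (ContinuousLinearMap.mul ℂ ℂ).holder 2 (hσ.toLp σ) (𝓕 f : L2C) :=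
    (Lp.fourierTransformₗᵢ E3 ℂ).apply_symm_apply _
  rw [h]
  filter_upwards [(ContinuousLinearMap.mul ℂ ℂ).coeFn_holder (r := 2) (hσ.toLp σ) (𝓕 f : L2C),
    hσ.coeFn_toLp] with ξ h1 h2
  rw [h1, h2]; rfl

/-- The symbol of the low-pass filter, the indicator of the ball of radius `r`. -/
noncomputable def lowSymbol (r : ℝ) : E3 → ℂ := (Metric.ball (0 : E3) r).indicator 1

theorem lowSymbol_of_lt {r : ℝ} {ξ : E3} (h : ‖ξ‖ < r) : lowSymbol r ξ = 1 :=
  Set.indicator_of_mem (by simpa using h) _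

theorem lowSymbol_of_le {r : ℝ} {ξ : E3} (h : r ≤ ‖ξ‖) : lowSymbol r ξ = 0 :=
  Set.indicator_of_notMem (by simpa using h) _

theorem measurable_lowSymbol (r : ℝ) : Measurable (lowSymbol r) :=
  measurable_one.indicator measurableSet_ball

theorem norm_derivSymbol_le (l : Fin 3) (ξ : E3) : ‖derivSymbol l ξ‖ ≤ 2 * Real.pi * ‖ξ‖ := by
  have : ‖derivSymbol l ξ‖ = 2 * Real.pi * ‖ξ l‖ := by
    simp [derivSymbol, abs_of_pos Real.pi_pos]
  rw [this]
  gcongr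
  exact PiLp.norm_apply_le ξ l

theorem memLp_lowSymbol (r : ℝ) : MemLp (lowSymbol r) ⊤ (volume : Measure E3) := by
  refine memLp_top_of_bound (measurable_lowSymbol r).aestronglyMeasurable 1 ?_
  refine Eventually.of_forall fun ξ => ?_
  rcases lt_or_ge ‖ξ‖ r with h | h
  · simp [lowSymbol_of_lt h]
  · simp [lowSymbol_of_le h]

theorem memLp_derivSymbol_mul_lowSymbol (l : Fin 3) (r : ℝ) :
    MemLp (fun ξ => derivSymbol l ξ * lowSymbol r ξ) ⊤ (volume : Measure E3) := by
  refine memLp_top_of_bound ((derivSymbol_temperate l).1.continuous.measurable.mul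
    (measurable_lowSymbol r)).aestronglyMeasurable (2 * Real.pi * |r|) ?_
  refine Eventually.of_forall fun ξ => ?_
  rcases lt_or_ge ‖ξ‖ r with h | h
  · rw [lowSymbol_of_lt h, mul_one]
    refine (norm_derivSymbol_le l ξ).trans ?_
    have := h.le.trans (le_abs_self r)
    gcongr
  · rw [lowSymbol_of_le h, mul_zero, norm_zero]; positivity

/-- The low-pass filter: the projection of `L²` onto the frequencies `‖ξ‖ < r`. -/
noncomputable def lowPass (r : ℝ) : L2C →L[ℂ] L2C := multiplier (lowSymbol r) (memLp_lowSymbol r)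

/-- The operator `∂_l` composed with the low-pass filter. -/
noncomputable def lowPassDeriv (l : Fin 3) (r : ℝ) : L2C →L[ℂ] L2C :=
  multiplier _ (memLp_derivSymbol_mul_lowSymbol l r)

theorem fourier_lowPass_ae (r : ℝ) (f : L2C) :
    ∀ᵐ ξ, (𝓕 (lowPass r f) : L2C) ξ = lowSymbol r ξ * (𝓕 f : L2C) ξ :=
  fourier_multiplier_ae _ f

theorem fourier_lowPassDeriv_ae (l : Fin 3) (r : ℝ) (f : L2C) :
    ∀ᵐ ξ, (𝓕 (lowPassDeriv l r f) : L2C) ξ = derivSymbol l ξ * lowSymbol r ξ * (𝓕 f : L2C) ξ :=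
  fourier_multiplier_ae _ f

theorem lineDeriv_lowPass (l : Fin 3) (r : ℝ) (f : L2C) :
    ∂_{e l} (lowPass r f : 𝓢'(E3, ℂ)) = lowPassDeriv l r f := by
  rw [lineDeriv_eq_iff]
  filter_upwards [fourier_lowPass_ae r f, fourier_lowPassDeriv_ae l r f] with ξ h1 h2
  rw [h1, h2, mul_assoc]

theorem norm_lowPassDeriv_le (l : Fin 3) (r : ℝ) (f : L2C) :
    ‖lowPassDeriv l r f‖ ≤ 2 * Real.pi * r * ‖lowPass r f‖ := by
  rw [← Lp.norm_fourier_eq (lowPassDeriv l r f), ← Lp.norm_fourier_eq (lowPass r f)]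
  refine Lp.norm_le_mul_norm_of_ae_le_mul ?_
  filter_upwards [fourier_lowPass_ae r f, fourier_lowPassDeriv_ae l r f] with ξ h1 h2
  rw [h1, h2]
  rcases lt_or_ge ‖ξ‖ r with h | h
  · rw [lowSymbol_of_lt h, mul_one, one_mul, norm_mul]
    gcongr
    refine (norm_derivSymbol_le l ξ).trans ?_
    gcongr
  · simp [lowSymbol_of_le h]

theorem ae_norm_lowPass_le {r : ℝ} (hr : 0 ≤ r) (f : L2C) :
    ∀ᵐ x, ‖lowPass r f x‖ ≤ bernsteinConst * √r ^ 3 * ‖lowPass r f‖ := by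
  refine bernstein hr ?_
  filter_upwards [fourier_lowPass_ae r f] with ξ h1 h
  rw [h1, lowSymbol_of_le h, zero_mul]

theorem ae_norm_lowPassDeriv_le (l : Fin 3) {r : ℝ} (hr : 0 ≤ r) (f : L2C) :
    ∀ᵐ x, ‖lowPassDeriv l r f x‖ ≤ 2 * Real.pi * bernsteinConst * √r ^ 5 * ‖lowPass r f‖ := by
  have hb := bernstein (g := lowPassDeriv l r f) hr (by
    filter_upwards [fourier_lowPassDeriv_ae l r f] with ξ h1 h
    rw [h1, lowSymbol_of_le h, mul_zero, zero_mul])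
  have hc : 0 ≤ bernsteinConst := Real.sqrt_nonneg _
  filter_upwards [hb] with x hx
  refine hx.trans ?_
  calc bernsteinConst * √r ^ 3 * ‖lowPassDeriv l r f‖
      ≤ bernsteinConst * √r ^ 3 * (2 * Real.pi * r * ‖lowPass r f‖) := by
        gcongr; exact norm_lowPassDeriv_le l r f
    _ = 2 * Real.pi * bernsteinConst * (√r ^ 3 * r) * ‖lowPass r f‖ := by ring
    _ = _ := by nth_rw 2 [← Real.sq_sqrt hr]; ring

theorem inner_lowPass (r : ℝ) (f g : L2C) : ⟪lowPass r f, lowPass r g⟫_ℂ = ⟪f, lowPass r g⟫_ℂ := by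
  rw [← Lp.inner_fourier_eq, ← Lp.inner_fourier_eq f, L2.inner_def, L2.inner_def]
  refine integral_congr_ae ?_
  filter_upwards [fourier_lowPass_ae r f, fourier_lowPass_ae r g] with ξ h1 h2
  rw [h1, h2]
  rcases lt_or_ge ‖ξ‖ r with h | h
  · simp [lowSymbol_of_lt h]
  · simp [lowSymbol_of_le h]

/-- The low frequencies of an integrable function are bounded by its `L¹` norm. -/
theorem norm_lowPass_le_of_integrable {r : ℝ} (hr : 0 ≤ r) {f : L2} (hf : Integrable f) :
    ‖lowPass r (cplx f)‖ ≤ bernsteinConst * √r ^ 3 * ∫ x, ‖f x‖ := by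
  set w := lowPass r (cplx f) with hw
  have hc : 0 ≤ bernsteinConst := Real.sqrt_nonneg _
  have h1 : ‖w‖ ^ 2 ≤ bernsteinConst * √r ^ 3 * ‖w‖ * ∫ x, ‖f x‖ := by
    have h2 : ((‖w‖ ^ 2 : ℝ) : ℂ) = ∫ x, (f x : ℂ) * w x := by
      rw [← inner_eq_integral_mul, hw, ← inner_lowPass, inner_self_eq_norm_sq_to_K]
      simp
    have h3 : ‖w‖ ^ 2 = ‖∫ x, (f x : ℂ) * w x‖ := by
      rw [← h2, Complex.norm_real]; simp
    rw [h3, ← integral_const_mul]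
    refine norm_integral_le_of_norm_le (hf.norm.const_mul _) ?_
    filter_upwards [ae_norm_lowPass_le hr (cplx f)] with x hx
    rw [norm_mul, Complex.norm_real, mul_comm]
    gcongr
  rcases (norm_nonneg w).eq_or_lt with h | h
  · rw [← h]; positivity
  · refine le_of_mul_le_mul_left ?_ h
    linarith

/-! ### Integration by parts -/

theorem conj_derivSymbol (l : Fin 3) (ξ : E3) : conj (derivSymbol l ξ) = -derivSymbol l ξ := by
  simp [derivSymbol, Complex.conj_ofNat]

/-- Integration by parts, read off from Plancherel's theorem. -/
theorem inner_lineDeriv {f f' g g' : L2C} {l : Fin 3} (hf : ∂_{e l} (f : 𝓢'(E3, ℂ)) = f')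
    (hg : ∂_{e l} (g : 𝓢'(E3, ℂ)) = g') : ⟪f, g'⟫_ℂ = -⟪f', g⟫_ℂ := by
  rw [← Lp.inner_fourier_eq, ← Lp.inner_fourier_eq f', L2.inner_def, L2.inner_def, ← integral_neg]
  refine integral_congr_ae ?_
  filter_upwards [(lineDeriv_eq_iff f f' l).1 hf, (lineDeriv_eq_iff g g' l).1 hg] with ξ h1 h2
  rw [h1, h2]
  simp only [RCLike.inner_apply, map_mul, conj_derivSymbol]
  ring

/-- The product of an `L²` function with a Schwartz function. -/
noncomputable def schwartzMul (φ : 𝓢(E3, ℂ)) (f : L2C) : L2C := (φ.memLp_top.toLp φ) • f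

theorem coeFn_schwartzMul (φ : 𝓢(E3, ℂ)) (f : L2C) : ∀ᵐ x, schwartzMul φ f x = φ x * f x := by
  filter_upwards [Lp.coeFn_lpSMul (r := 2) (φ.memLp_top.toLp φ) f,
    (φ.memLp_top (volume : Measure E3)).coeFn_toLp] with x h1 h2
  rw [schwartzMul, h1, Pi.smul_apply', h2, smul_eq_mul]

/-- The Leibniz rule for a Schwartz factor, obtained by testing the weak derivative of `a` against
the product of the test function with `φ`. -/
theorem lineDeriv_schwartzMul {a a' : L2C} {l : Fin 3} (ha : ∂_{e l} (a : 𝓢'(E3, ℂ)) = a')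
    (φ : 𝓢(E3, ℂ)) :
    ∂_{e l} (schwartzMul φ a : 𝓢'(E3, ℂ))
      = (schwartzMul (∂_{e l} φ) a + schwartzMul φ a' : L2C) := by
  ext ψ
  have h := congrArg (fun T : 𝓢'(E3, ℂ) =>
    T (SchwartzMap.pairing (ContinuousLinearMap.mul ℂ ℂ) ψ φ)) ha
  simp only [TemperedDistribution.lineDerivOp_apply_apply, Lp.toTemperedDistribution_apply] at h ⊢
  have hd : ∀ x, (∂_{e l} (SchwartzMap.pairing (ContinuousLinearMap.mul ℂ ℂ) ψ φ)) x
      = (∂_{e l} ψ) x * φ x + ψ x * (∂_{e l} φ) x := by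
    intro x
    simp only [SchwartzMap.lineDerivOp_apply_eq_fderiv]
    have : ((SchwartzMap.pairing (ContinuousLinearMap.mul ℂ ℂ) ψ φ : 𝓢(E3, ℂ)) : E3 → ℂ)
        = fun x => ψ x * φ x := by ext x; simp
    rw [this, fderiv_fun_mul ψ.differentiableAt φ.differentiableAt]
    simp; ring
  have e1 : ∫ x, (-∂_{e l} ψ) x • (schwartzMul φ a) x
      = (∫ x, (-∂_{e l} (SchwartzMap.pairing (ContinuousLinearMap.mul ℂ ℂ) ψ φ)) x • a x)
        + ∫ x, ψ x * (schwartzMul (∂_{e l} φ) a) x := by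
    rw [← integral_add]
    · refine integral_congr_ae ?_
      filter_upwards [coeFn_schwartzMul φ a, coeFn_schwartzMul (∂_{e l} φ) a] with x h1 h2
      rw [h1, h2, neg_apply, neg_apply, hd]
      simp only [smul_eq_mul]; ring
    · exact integrable_schwartz_mul _ _
    · exact integrable_schwartz_mul _ _
  have e2 : ∫ x, ψ x • (schwartzMul (∂_{e l} φ) a + schwartzMul φ a' : L2C) x
      = (∫ x, ψ x * (schwartzMul (∂_{e l} φ) a) x)
        + ∫ x, (SchwartzMap.pairing (ContinuousLinearMap.mul ℂ ℂ) ψ φ) x • a' x := by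
    rw [← integral_add]
    · refine integral_congr_ae ?_
      filter_upwards [coeFn_schwartzMul φ a',
        Lp.coeFn_add (schwartzMul (∂_{e l} φ) a) (schwartzMul φ a')] with x h1 h2
      rw [h2, Pi.add_apply, h1]
      simp only [smul_eq_mul, SchwartzMap.pairing_apply_apply, ContinuousLinearMap.mul_apply']; ring
    · exact integrable_schwartz_mul _ _
    · exact integrable_schwartz_mul _ _
  rw [e1, e2, h, add_comm]

/-- The Leibniz rule for weak derivatives. No regularity beyond first weak derivatives in `L²` is
needed: tested against `φ`, it is the integration by parts of `b` against `φ a`. -/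
theorem lineDeriv_mul {a a' : L2C} {b b' : L2} {l : Fin 3}
    (ha : ∂_{e l} (a : 𝓢'(E3, ℂ)) = a') (hb : ∂_{e l} (toDist b) = toDist b')
    {P P' : L2C} (hP : ∀ᵐ x, P x = a x * b x) (hP' : ∀ᵐ x, P' x = a' x * b x + a x * b' x) :
    ∂_{e l} (P : 𝓢'(E3, ℂ)) = P' := by
  ext φ
  have h := inner_lineDeriv hb (lineDeriv_schwartzMul ha φ)
  simp only [TemperedDistribution.lineDerivOp_apply_apply, Lp.toTemperedDistribution_apply]
  have e1 : ∫ x, (-∂_{e l} φ) x • P x = -⟪cplx b, schwartzMul (∂_{e l} φ) a⟫_ℂ := by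
    rw [inner_eq_integral_mul, ← integral_neg]
    refine integral_congr_ae ?_
    filter_upwards [coeFn_schwartzMul (∂_{e l} φ) a, hP] with x h1 h2
    rw [h1, h2, neg_apply, smul_eq_mul]; ring
  have hi : ∀ (f : L2) (g : L2C), Integrable (fun x => (f x : ℂ) * g x) := by
    intro f g
    refine ((Lp.memLp f).ofReal (K := ℂ)).integrable_mul (Lp.memLp g)
  have e2 : ∫ x, φ x • P' x = ⟪cplx b, schwartzMul φ a'⟫_ℂ + ⟪cplx b', schwartzMul φ a⟫_ℂ := by
    rw [inner_eq_integral_mul, inner_eq_integral_mul, ← integral_add (hi _ _) (hi _ _)]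
    refine integral_congr_ae ?_
    filter_upwards [coeFn_schwartzMul φ a, coeFn_schwartzMul φ a', hP'] with x h1 h2 h3
    rw [h1, h2, h3, smul_eq_mul]; ring
  rw [inner_add_right] at h
  rw [e1, e2]
  linear_combination -h

/-! ### Pointwise products and the transport terms -/

/-- The pointwise product of two `L²` functions, if it is square integrable (and `0` otherwise). It
is used only when the first factor is essentially bounded. -/
noncomputable def pmul (b f : L2) : L2 := by
  classical exact if h : MemLp (fun x => b x * f x) 2 (volume : Measure E3) then h.toLp _ else 0

theorem EssBdd.memLp_mul {𝕜 : Type*} [NormedRing 𝕜] {b f : E3 → 𝕜} (hb : EssBdd b)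
    (hbm : AEStronglyMeasurable b) (hf : MemLp f 2) : MemLp (fun x => b x * f x) 2 := by
  obtain ⟨M, hM⟩ := hb
  exact hf.mul (memLp_top_of_bound hbm M hM)

theorem coeFn_pmul {b : L2} (hb : EssBdd b) (f : L2) : ∀ᵐ x, pmul b f x = b x * f x := by
  have h := hb.memLp_mul (Lp.aestronglyMeasurable b) (Lp.memLp f)
  rw [pmul, dif_pos h]
  exact h.coeFn_toLp

theorem inner_pmul {v : L2} (hv : EssBdd v) (f g : L2) : ⟪pmul v f, g⟫_ℝ = ⟪pmul v g, f⟫_ℝ := by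
  rw [L2.inner_def, L2.inner_def]
  refine integral_congr_ae ?_
  filter_upwards [coeFn_pmul hv f, coeFn_pmul hv g] with x h1 h2
  rw [h1, h2]; simp; ring

/-- A divergence-free field is orthogonal to the gradient of an `L²` function. -/
theorem inner_eq_zero_of_div {v : Fin 3 → L2C} (hv : ∑ l, ∂_{e l} (v l : 𝓢'(E3, ℂ)) = 0)
    {P : L2C} {P' : Fin 3 → L2C} (hP : ∀ l, ∂_{e l} (P : 𝓢'(E3, ℂ)) = P' l) :
    ∑ l, ⟪v l, P' l⟫_ℂ = 0 := by
  have h1 : ∀ l, ⟪v l, P' l⟫_ℂ = ∫ ξ, ⟪(𝓕 (v l) : L2C) ξ, (𝓕 (P' l) : L2C) ξ⟫_ℂ := by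
    intro l; rw [← Lp.inner_fourier_eq, L2.inner_def]
  simp_rw [h1]
  rw [← integral_finsetSum _ (fun l _ => L2.integrable_inner _ _)]
  refine integral_eq_zero_of_ae ?_
  filter_upwards [fourier_div_ae hv, ae_all_iff.2 fun l => (lineDeriv_eq_iff P (P' l) l).1 (hP l)]
    with ξ h2 h3
  have h4 := congrArg conj h2
  simp only [map_sum, map_mul, conj_derivSymbol, map_zero, neg_mul, Finset.sum_neg_distrib,
    neg_eq_zero] at h4
  simp only [h3, RCLike.inner_apply, Pi.zero_apply]
  rw [← mul_zero ((𝓕 P : L2C) ξ), ← h4, Finset.mul_sum]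
  exact Finset.sum_congr rfl fun l _ => by ring

/-- The transport operator `v·∇` of a divergence-free field is skew-symmetric. -/
theorem sum_inner_transport {v : Fin 3 → L2} (hv : ∑ l, ∂_{e l} (toDist (v l)) = 0)
    (hvb : ∀ l, EssBdd (v l)) {a : L2C} {a' : Fin 3 → L2C}
    (ha : ∀ l, ∂_{e l} (a : 𝓢'(E3, ℂ)) = a' l) (hab : EssBdd a)
    {b : L2} {b' : Fin 3 → L2} (hb : HasWeakGradient (toDist b) b') (hbb : EssBdd b) :
    ∑ l, (⟪cplx (pmul (v l) b), a' l⟫_ℂ + ⟪cplx (pmul (v l) (b' l)), a⟫_ℂ) = 0 := by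
  have hbb' : EssBdd (fun x => (b x : ℂ)) := by
    obtain ⟨M, hM⟩ := hbb
    exact ⟨M, hM.mono fun x hx => by rwa [Complex.norm_real]⟩
  have hm : ∀ f : L2, MemLp (fun x => (f x : ℂ)) 2 := fun f => (Lp.memLp f).ofReal
  have hP : MemLp (fun x => a x * b x) 2 := hab.memLp_mul (Lp.aestronglyMeasurable a) (hm b)
  have hP' : ∀ l, MemLp (fun x => a' l x * b x + a x * b' l x) 2 := fun l =>
    ((hbb'.memLp_mul (hm b).1 (Lp.memLp (a' l))).congr_norm
      ((Lp.aestronglyMeasurable (a' l)).mul (hm b).1)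
      (Eventually.of_forall fun x => by simp [mul_comm])).add
    (hab.memLp_mul (Lp.aestronglyMeasurable a) (hm (b' l)))
  have h0 := inner_eq_zero_of_div (v := fun l => cplx (v l)) hv (P := hP.toLp _)
    (P' := fun l => (hP' l).toLp _)
    (fun l => lineDeriv_mul (ha l) (hb l) hP.coeFn_toLp (hP' l).coeFn_toLp)
  rw [← h0]
  refine Finset.sum_congr rfl fun l _ => ?_
  have hi : ∀ (f : L2) (g : L2C), Integrable (fun x => (f x : ℂ) * g x) := fun f g =>
    (hm f).integrable_mul (Lp.memLp g)
  rw [inner_eq_integral_mul, inner_eq_integral_mul, inner_eq_integral_mul,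
    ← integral_add (hi _ _) (hi _ _)]
  refine integral_congr_ae ?_
  filter_upwards [coeFn_pmul (hvb l) b, coeFn_pmul (hvb l) (b' l), (hP' l).coeFn_toLp]
    with x h1 h2 h3
  rw [h1, h2, h3]; push_cast; ring

theorem essBdd_cplx {f : L2} (hf : EssBdd f) : EssBdd (cplx f) := by
  obtain ⟨M, hM⟩ := hf
  refine ⟨M, ?_⟩
  filter_upwards [hM, coeFn_cplx f] with x h1 h2
  rwa [h2, Complex.norm_real]

/-- The skew-symmetry of the transport operator between two real functions. -/
theorem sum_inner_transport_real {v : Fin 3 → L2} (hv : ∑ l, ∂_{e l} (toDist (v l)) = 0)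
    (hvb : ∀ l, EssBdd (v l)) {a : L2} {a' : Fin 3 → L2}
    (ha : HasWeakGradient (toDist a) a') (hab : EssBdd a)
    {b : L2} {b' : Fin 3 → L2} (hb : HasWeakGradient (toDist b) b') (hbb : EssBdd b) :
    ∑ l, ⟪pmul (v l) (a' l), b⟫_ℝ = -∑ l, ⟪pmul (v l) (b' l), a⟫_ℝ := by
  have h := sum_inner_transport hv hvb (a := cplx a) (a' := fun l => cplx (a' l)) ha
    (essBdd_cplx hab) hb hbb
  simp only [inner_cplx] at h
  rw [eq_neg_iff_add_eq_zero, ← Finset.sum_add_distrib]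
  have h' : ∑ l, (⟪pmul (v l) b, a' l⟫_ℝ + ⟪pmul (v l) (b' l), a⟫_ℝ) = 0 := by exact_mod_cast h
  rw [← h']
  exact Finset.sum_congr rfl fun l _ => by rw [inner_pmul (hvb l)]

/-! ### Pressure and viscosity -/

/-- Gradients are orthogonal to divergence-free fields, even if the potential `p` is only a tempered
distribution. -/
theorem sum_inner_gradient {p : 𝓢'(E3, ℂ)} {g w : Fin 3 → L2C} (hg : ∀ l, ∂_{e l} p = g l)
    (hw : ∀ᵐ ξ, ∑ l, derivSymbol l ξ * (𝓕 (w l) : L2C) ξ = 0) : ∑ l, ⟪g l, w l⟫_ℂ = 0 := by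
  have h1 : ∀ l, ⟪g l, w l⟫_ℂ = ∫ ξ, ⟪(𝓕 (g l) : L2C) ξ, (𝓕 (w l) : L2C) ξ⟫_ℂ := by
    intro l; rw [← Lp.inner_fourier_eq, L2.inner_def]
  simp_rw [h1]
  rw [← integral_finsetSum _ (fun l _ => L2.integrable_inner _ _)]
  refine integral_eq_zero_of_ae ?_
  have hne : ∀ᵐ ξ : E3, ξ ≠ 0 := Measure.ae_ne volume 0
  filter_upwards [hw, hne, ae_all_iff.2 fun j => ae_all_iff.2 fun k => fourier_gradient_ae hg j k]
    with ξ h2 h3 h4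
  -- Away from the origin some `ξ j` is nonzero, and the sum vanishes after multiplication by it.
  obtain ⟨j, hj⟩ : ∃ j, ξ j ≠ 0 := by
    by_contra! h
    exact h3 (by ext j; simp [h j])
  have hs : derivSymbol j ξ ≠ 0 := by
    simp [derivSymbol, hj, Real.pi_ne_zero]
  have hs' : conj (derivSymbol j ξ) ≠ 0 := by simpa using hs
  refine mul_left_cancel₀ hs' ?_
  simp only [RCLike.inner_apply, Pi.zero_apply, mul_zero]
  rw [Finset.mul_sum, ← mul_zero (-conj ((𝓕 (g j) : L2C) ξ)), ← h2, Finset.mul_sum]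
  refine Finset.sum_congr rfl fun k _ => ?_
  have h5 := congrArg conj (h4 j k)
  simp only [map_mul, conj_derivSymbol] at h5 ⊢
  linear_combination (𝓕 (w k) : L2C) ξ * h5

theorem re_inner_eq_integral_fourier (f g : L2C) :
    (⟪f, g⟫_ℂ).re = ∫ ξ, (conj ((𝓕 f : L2C) ξ) * (𝓕 g : L2C) ξ).re := by
  rw [← Lp.inner_fourier_eq, L2.inner_def]
  refine (integral_re (𝕜 := ℂ) (L2.integrable_inner _ _)).symm.trans ?_
  refine integral_congr_ae (Eventually.of_forall fun ξ => ?_)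
  exact congrArg Complex.re (mul_comm _ _)

theorem integrable_re_fourier (f g : L2C) :
    Integrable fun ξ => (conj ((𝓕 f : L2C) ξ) * (𝓕 g : L2C) ξ).re := by
  refine ((L2.integrable_inner (𝕜 := ℂ) (𝓕 f : L2C) (𝓕 g)).re).congr
    (Eventually.of_forall fun ξ => ?_)
  exact congrArg Complex.re (mul_comm _ _)

/-- Viscosity dissipates the low frequencies. -/
theorem re_inner_laplacian_lowPass_nonpos {f g : L2C} (h : Δ (f : 𝓢'(E3, ℂ)) = g) (r : ℝ) :
    (⟪g, lowPass r f⟫_ℂ).re ≤ 0 := by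
  rw [re_inner_eq_integral_fourier]
  refine integral_nonpos_of_ae ?_
  filter_upwards [fourier_laplacian_ae h, fourier_lowPass_ae r f] with ξ h1 h2
  rw [h1, h2]
  rcases lt_or_ge ‖ξ‖ r with hr | hr
  · rw [lowSymbol_of_lt hr, one_mul, map_mul, map_neg, Complex.conj_ofReal, mul_assoc,
      ← Complex.normSq_eq_conj_mul_self, ← Complex.ofReal_neg, ← Complex.ofReal_mul,
      Complex.ofReal_re]
    have := Complex.normSq_nonneg ((𝓕 f : L2C) ξ)
    simp only [Pi.zero_apply]
    rw [neg_mul, Left.neg_nonpos_iff]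
    positivity
  · simp [lowSymbol_of_le hr]

/-- Viscosity dissipates the frequencies above `r` at rate at least `(2πr)²`. -/
theorem re_inner_laplacian_le {f g : L2C} (h : Δ (f : 𝓢'(E3, ℂ)) = g) {r : ℝ} (hr0 : 0 ≤ r) :
    (⟪g, f⟫_ℂ).re ≤ -((2 * Real.pi * r) ^ 2 * (‖f‖ ^ 2 - ‖lowPass r f‖ ^ 2)) := by
  have h1 : ‖f‖ ^ 2 = (⟪f, f⟫_ℂ).re := (inner_self_eq_norm_sq (𝕜 := ℂ) f).symm
  have h2 : ‖lowPass r f‖ ^ 2 = (⟪f, lowPass r f⟫_ℂ).re := by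
    rw [← inner_lowPass]; exact (inner_self_eq_norm_sq (𝕜 := ℂ) _).symm
  rw [h1, h2, re_inner_eq_integral_fourier, re_inner_eq_integral_fourier,
    re_inner_eq_integral_fourier, ← integral_sub (integrable_re_fourier _ _)
      (integrable_re_fourier _ _), ← integral_const_mul, ← integral_neg]
  refine integral_mono_ae (integrable_re_fourier _ _)
    (((integrable_re_fourier _ _).sub (integrable_re_fourier _ _)).const_mul _).neg ?_
  filter_upwards [fourier_laplacian_ae h, fourier_lowPass_ae r f] with ξ h1 h2
  rw [h1, h2]
  have hn := Complex.normSq_nonneg ((𝓕 f : L2C) ξ)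
  rw [map_mul, map_neg, Complex.conj_ofReal, mul_assoc,
    ← Complex.normSq_eq_conj_mul_self, ← Complex.ofReal_neg, ← Complex.ofReal_mul,
    Complex.ofReal_re]
  rcases lt_or_ge ‖ξ‖ r with hr | hr
  · rw [lowSymbol_of_lt hr, one_mul, ← Complex.normSq_eq_conj_mul_self, sub_self, mul_zero,
      neg_zero, neg_mul, Left.neg_nonpos_iff]
    positivity
  · rw [lowSymbol_of_le hr, zero_mul, mul_zero]
    simp only [Complex.ofReal_re, Complex.zero_re, sub_zero, neg_mul, mul_pow]
    gcongr

/-! ### The energy identity -/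

/-- The advection term `(v·∇)f`, where `f'` is the gradient of `f`. -/
noncomputable def transport (v f' : Fin 3 → L2) : L2 := ∑ l, pmul (v l) (f' l)

theorem coeFn_transport {v : Fin 3 → L2} (hv : ∀ l, EssBdd (v l)) (f' : Fin 3 → L2) :
    ∀ᵐ x, transport v f' x = ∑ l, v l x * f' l x := by
  filter_upwards [Lp.coeFn_fun_finsetSum Finset.univ fun l => pmul (v l) (f' l),
    ae_all_iff.2 fun l => coeFn_pmul (hv l) (f' l)] with x h1 h2
  rw [transport, h1]
  exact Finset.sum_congr rfl fun l _ => h2 l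

theorem inner_transport_swap {v : Fin 3 → L2} (hv : ∑ l, ∂_{e l} (toDist (v l)) = 0)
    (hvb : ∀ l, EssBdd (v l)) {a : L2} {a' : Fin 3 → L2}
    (ha : HasWeakGradient (toDist a) a') (hab : EssBdd a)
    {b : L2} {b' : Fin 3 → L2} (hb : HasWeakGradient (toDist b) b') (hbb : EssBdd b) :
    ⟪transport v a', b⟫_ℝ = -⟪transport v b', a⟫_ℝ := by
  rw [transport, transport, sum_inner, sum_inner]
  exact sum_inner_transport_real hv hvb ha hab hb hbb

theorem inner_transport_self {v : Fin 3 → L2} (hv : ∑ l, ∂_{e l} (toDist (v l)) = 0)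
    (hvb : ∀ l, EssBdd (v l)) {a : L2} {a' : Fin 3 → L2}
    (ha : HasWeakGradient (toDist a) a') (hab : EssBdd a) : ⟪transport v a', a⟫_ℝ = 0 := by
  have := inner_transport_swap hv hvb ha hab ha hab
  linarith

/-- The momentum equation as an identity in `L²`. -/
theorem momentum_eq {μ : ℝ} {u : Fin 3 → L2} {F : Fin 3 → Fin 3 → L2} (hu : ∀ l, EssBdd (u l))
    (hF : ∀ l i, EssBdd (F l i)) {ut Lu Dp : L2} {Du : Fin 3 → L2} {DF : Fin 3 → Fin 3 → L2}
    (h : ∀ᵐ x : E3, ut x - μ * Lu x + (∑ l, u l x * Du l x) + Dp x = ∑ i, ∑ l, F l i x * DF i l x) :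
    ut = μ • Lu - transport u Du - Dp + ∑ i, transport (fun l => F l i) (DF i) := by
  refine Lp.ext ?_
  filter_upwards [h, coeFn_transport hu Du,
    ae_all_iff.2 fun i => coeFn_transport (fun l => hF l i) (DF i),
    Lp.coeFn_fun_finsetSum Finset.univ fun i => transport (fun l => F l i) (DF i),
    Lp.coeFn_add (μ • Lu - transport u Du - Dp) (∑ i, transport (fun l => F l i) (DF i)),
    Lp.coeFn_sub (μ • Lu - transport u Du) Dp, Lp.coeFn_sub (μ • Lu) (transport u Du),
    Lp.coeFn_smul μ Lu] with x h1 h2 h3 h4 h5 h6 h7 h8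
  rw [h5, Pi.add_apply, h6, Pi.sub_apply, h7, Pi.sub_apply, h8, Pi.smul_apply, h2, h4, smul_eq_mul,
    Finset.sum_congr rfl fun i _ => h3 i]
  linarith

/-- The equation for a column entry of `F` as an identity in `L²`. -/
theorem deformation_eq {ν : ℝ} {u G : Fin 3 → L2} (hu : ∀ l, EssBdd (u l))
    (hG : ∀ l, EssBdd (G l)) {f ft : L2} {Df Du : Fin 3 → L2}
    (h : ∀ᵐ x : E3, ft x + ν * f x + (∑ l, u l x * Df l x) = ∑ l, G l x * Du l x) :
    ft = transport G Du - transport u Df - ν • f := by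
  refine Lp.ext ?_
  filter_upwards [h, coeFn_transport hu Df, coeFn_transport hG Du,
    Lp.coeFn_sub (transport G Du - transport u Df) (ν • f),
    Lp.coeFn_sub (transport G Du) (transport u Df), Lp.coeFn_smul ν f] with x h1 h2 h3 h4 h5 h6
  rw [h4, Pi.sub_apply, h5, Pi.sub_apply, h6, Pi.smul_apply, h2, h3, smul_eq_mul]
  linarith

/-- The energy `‖u‖² + ‖F‖²`. -/
noncomputable def energy (u : Fin 3 → L2) (F : Fin 3 → Fin 3 → L2) : ℝ :=
  (∑ k, ‖u k‖ ^ 2) + ∑ k, ∑ j, ‖F k j‖ ^ 2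

/-- The energy of the velocity at the frequencies below `r`. -/
noncomputable def lowEnergy (r : ℝ) (u : Fin 3 → L2) : ℝ := ∑ k, ‖lowPass r (cplx (u k))‖ ^ 2

theorem sum_re_inner_eq_zero {f g : Fin 3 → L2C} (h : ∑ k, ⟪f k, g k⟫_ℂ = 0) :
    ∑ k, (⟪f k, g k⟫_ℂ).re = 0 := by
  rw [← Complex.re_sum, h, Complex.zero_re]

/-- The energy inequality. The transport terms cancel, and the viscous dissipation is bounded from
below by its part above the frequency `r`. -/
theorem SolvesAt.energy_hasDerivAt {μ ν : ℝ} (hμ : 0 < μ) {u : ℝ → Fin 3 → L2}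
    {F : ℝ → Fin 3 → Fin 3 → L2} {t : ℝ} (h : SolvesAt μ ν u F t)
    (hu : ∀ k, EssBdd (u t k)) (hF : ∀ k j, EssBdd (F t k j))
    (hdu : ∑ k, ∂_{e k} (toDist (u t k)) = 0)
    (hdF : ∀ j, ∑ l, ∂_{e l} (toDist (F t l j)) = 0) :
    ∃ D, HasDerivAt (fun s => energy (u s) (F s)) D t ∧ ∀ r, 0 ≤ r →
      D ≤ -(2 * μ * (2 * Real.pi * r) ^ 2 * ((∑ k, ‖u t k‖ ^ 2) - lowEnergy r (u t)))
        - 2 * ν * ∑ k, ∑ j, ‖F t k j‖ ^ 2 := by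
  obtain ⟨ut, Du, Lu, Ft, DF, p, Dp, hut, hFt, hDu, hLu, hDF, hDp, h1, h2⟩ := h
  refine ⟨(∑ k, 2 * ⟪u t k, ut k⟫_ℝ) + ∑ k, ∑ j, 2 * ⟪F t k j, Ft k j⟫_ℝ, ?_, ?_⟩
  · exact (HasDerivAt.fun_sum fun k _ => (hut k).norm_sq).add
      (HasDerivAt.fun_sum fun k _ => HasDerivAt.fun_sum fun j _ => (hFt k j).norm_sq)
  intro r hr
  have hp : ∑ k, ⟪Dp k, u t k⟫_ℝ = 0 := by
    have := sum_inner_gradient (g := fun k => cplx (Dp k)) (w := fun k => cplx (u t k)) hDp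
      (fourier_div_ae hdu)
    simp only [inner_cplx] at this
    exact_mod_cast this
  have e1 : ∀ k, ⟪u t k, ut k⟫_ℝ = μ * ⟪Lu k, u t k⟫_ℝ - ⟪Dp k, u t k⟫_ℝ
      + ∑ i, ⟪transport (fun l => F t l i) (DF k i), u t k⟫_ℝ := by
    intro k
    rw [real_inner_comm, momentum_eq hu hF (h1 k), inner_add_left, inner_sub_left, inner_sub_left,
      inner_transport_self hdu hu (hDu k) (hu k), inner_smul_left, sum_inner]
    simp
  have e2 : ∀ k j, ⟪F t k j, Ft k j⟫_ℝ = -⟪transport (fun l => F t l j) (DF k j), u t k⟫_ℝ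
      - ν * ‖F t k j‖ ^ 2 := by
    intro k j
    rw [real_inner_comm, deformation_eq hu (fun l => hF l j) (h2 k j), inner_sub_left,
      inner_sub_left, inner_transport_self hdu hu (hDF k j) (hF k j), inner_smul_left,
      inner_transport_swap (hdF j) (fun l => hF l j) (hDu k) (hu k) (hDF k j) (hF k j),
      real_inner_self_eq_norm_sq]
    simp
  have e3 : (∑ k, 2 * ⟪u t k, ut k⟫_ℝ) + ∑ k, ∑ j, 2 * ⟪F t k j, Ft k j⟫_ℝ
      = 2 * μ * (∑ k, ⟪Lu k, u t k⟫_ℝ) - 2 * ν * ∑ k, ∑ j, ‖F t k j‖ ^ 2 := by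
    simp only [e1, e2, ← Finset.mul_sum, Finset.sum_add_distrib, Finset.sum_sub_distrib,
      Finset.sum_neg_distrib, hp]
    ring
  have e4 : ∑ k, ⟪Lu k, u t k⟫_ℝ
      ≤ -((2 * Real.pi * r) ^ 2 * ((∑ k, ‖u t k‖ ^ 2) - lowEnergy r (u t))) := by
    rw [lowEnergy, ← Finset.sum_sub_distrib, Finset.mul_sum, ← Finset.sum_neg_distrib]
    refine Finset.sum_le_sum fun k _ => ?_
    have := re_inner_laplacian_le (f := cplx (u t k)) (g := cplx (Lu k)) (hLu k) hr
    rw [inner_cplx, Complex.ofReal_re, norm_cplx] at this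
    exact this
  rw [e3]
  nlinarith

/-! ### The growth of the low frequencies -/

/-- The pairing of a product of two `L²` functions with a bounded function. -/
theorem norm_inner_pmul_le {v : L2} (hv : EssBdd v) (b : L2) {g : L2C} {M : ℝ}
    (hg : ∀ᵐ x, ‖g x‖ ≤ M) : ‖⟪cplx (pmul v b), g⟫_ℂ‖ ≤ M * (‖v‖ * ‖b‖) := by
  have hM : 0 ≤ M := by
    obtain ⟨x, hx⟩ := hg.exists
    exact (norm_nonneg _).trans hx
  have h1 : ∫ x, |v x| * |b x| ≤ ‖v‖ * ‖b‖ := by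
    have h2 := real_inner_le_norm |v| |b|
    rw [norm_abs_eq_norm, norm_abs_eq_norm, L2.inner_def] at h2
    refine le_trans (le_of_eq ?_) h2
    refine integral_congr_ae ?_
    filter_upwards [Lp.coeFn_abs v, Lp.coeFn_abs b] with x h3 h4
    rw [h3, h4]; simp [mul_comm]
  have hi : Integrable (fun x => |v x| * |b x|) :=
    (Lp.memLp v).abs.integrable_mul (Lp.memLp b).abs
  rw [inner_eq_integral_mul]
  calc ‖∫ x, (pmul v b x : ℂ) * g x‖ ≤ ∫ x, M * (|v x| * |b x|) := by
        refine norm_integral_le_of_norm_le (hi.const_mul _) ?_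
        filter_upwards [hg, coeFn_pmul hv b] with x h3 h4
        rw [h4, norm_mul, Complex.norm_real, Real.norm_eq_abs, abs_mul, mul_comm]
        gcongr
    _ = M * ∫ x, |v x| * |b x| := integral_const_mul _ _
    _ ≤ _ := by gcongr

/-- The advection of `b` by `v` contributes little to the low frequencies of any function: the
derivative is moved to the low-frequency factor, where it costs a power of `r`. -/
theorem abs_re_inner_transport_lowPass_le {v : Fin 3 → L2} (hv : ∑ l, ∂_{e l} (toDist (v l)) = 0)
    (hvb : ∀ l, EssBdd (v l)) {b : L2} {b' : Fin 3 → L2} (hb : HasWeakGradient (toDist b) b')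
    (hbb : EssBdd b) {r : ℝ} (hr : 0 ≤ r) (f : L2C) :
    |(⟪cplx (transport v b'), lowPass r f⟫_ℂ).re|
      ≤ 2 * Real.pi * bernsteinConst * √r ^ 5 * ‖lowPass r f‖ * ((∑ l, ‖v l‖) * ‖b‖) := by
  have h := sum_inner_transport hv hvb (a := lowPass r f) (a' := fun l => lowPassDeriv l r f)
    (fun l => lineDeriv_lowPass l r f) ⟨_, ae_norm_lowPass_le hr f⟩ hb hbb
  rw [Finset.sum_add_distrib] at h
  have h1 : ⟪cplx (transport v b'), lowPass r f⟫_ℂ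
      = ∑ l, ⟪cplx (pmul (v l) (b' l)), lowPass r f⟫_ℂ := by
    rw [← cplxL_apply, transport, map_sum, sum_inner]
    rfl
  rw [h1, eq_neg_of_add_eq_zero_right h]
  refine (Complex.abs_re_le_norm _).trans ?_
  rw [norm_neg, Finset.sum_mul, Finset.mul_sum]
  refine (norm_sum_le _ _).trans (Finset.sum_le_sum fun l _ => ?_)
  exact norm_inner_pmul_le (hvb l) b (ae_norm_lowPassDeriv_le l hr f)

theorem real_inner_eq_re (f g : L2C) : ⟪f, g⟫_ℝ = (⟪f, g⟫_ℂ).re := by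
  rw [L2.inner_def, L2.inner_def]
  refine Eq.trans ?_ (integral_re (𝕜 := ℂ) (L2.integrable_inner _ _))
  rfl

theorem sum_sq_le_three_mul (a : Fin 3 → ℝ) : (∑ l, a l) ^ 2 ≤ 3 * ∑ l, a l ^ 2 := by
  have := sq_sum_le_card_mul_sum_sq (s := Finset.univ) (f := a)
  simpa using this

/-- The low frequencies of the velocity grow at a rate controlled by the energy. The pressure and
the viscosity do not contribute. -/
theorem SolvesAt.lowEnergy_hasDerivAt {μ ν : ℝ} (hμ : 0 < μ) {u : ℝ → Fin 3 → L2}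
    {F : ℝ → Fin 3 → Fin 3 → L2} {t : ℝ} (h : SolvesAt μ ν u F t)
    (hu : ∀ k, EssBdd (u t k)) (hF : ∀ k j, EssBdd (F t k j))
    (hdu : ∑ k, ∂_{e k} (toDist (u t k)) = 0)
    (hdF : ∀ j, ∑ l, ∂_{e l} (toDist (F t l j)) = 0) {r : ℝ} (hr : 0 ≤ r) :
    ∃ D, HasDerivAt (fun s => lowEnergy r (u s)) D t ∧
      D ≤ 2 * (6 * Real.pi * bernsteinConst * √r ^ 5 * energy (u t) (F t))
        * √(lowEnergy r (u t)) := by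
  obtain ⟨ut, Du, Lu, Ft, DF, p, Dp, hut, hFt, hDu, hLu, hDF, hDp, h1, h2⟩ := h
  set w : Fin 3 → L2C := fun k => lowPass r (cplx (u t k)) with hw
  set Y := √(lowEnergy r (u t)) with hY
  have hwY : ∀ k, ‖w k‖ ≤ Y := fun k => Real.le_sqrt_of_sq_le
    (Finset.single_le_sum (f := fun k => ‖w k‖ ^ 2) (fun _ _ => by positivity) (Finset.mem_univ k))
  have hc : 0 ≤ bernsteinConst := Real.sqrt_nonneg _
  refine ⟨∑ k, 2 * ⟪w k, lowPass r (cplx (ut k))⟫_ℝ, ?_, ?_⟩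
  · refine HasDerivAt.fun_sum fun k _ => HasDerivAt.norm_sq ?_
    exact (((lowPass r).restrictScalars ℝ) ∘L cplxL).hasFDerivAt.comp_hasDerivAt t (hut k)
  have e0 : ∀ k, ⟪w k, lowPass r (cplx (ut k))⟫_ℝ = (⟪cplx (ut k), w k⟫_ℂ).re := by
    intro k
    rw [← real_inner_eq_re, real_inner_comm, real_inner_eq_re, real_inner_eq_re, hw, inner_lowPass]
  have hp : ∑ k, (⟪cplx (Dp k), w k⟫_ℂ).re = 0 := by
    refine sum_re_inner_eq_zero (sum_inner_gradient (g := fun k => cplx (Dp k)) hDp ?_)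
    filter_upwards [fourier_div_ae hdu,
      ae_all_iff.2 fun k => fourier_lowPass_ae r (cplx (u t k))] with ξ h3 h4
    simp only [hw, h4]
    rw [← mul_zero (lowSymbol r ξ), ← h3, Finset.mul_sum]
    exact Finset.sum_congr rfl fun k _ => by ring
  have e1 : ∀ k, (⟪cplx (ut k), w k⟫_ℂ).re = μ * (⟪cplx (Lu k), w k⟫_ℂ).re
      - (⟪cplx (transport (u t) (Du k)), w k⟫_ℂ).re - (⟪cplx (Dp k), w k⟫_ℂ).re
      + ∑ i, (⟪cplx (transport (fun l => F t l i) (DF k i)), w k⟫_ℂ).re := by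
    intro k
    rw [← real_inner_eq_re, ← cplxL_apply, momentum_eq hu hF (h1 k), map_add, map_sub, map_sub,
      map_sum, map_smul, inner_add_left, inner_sub_left, inner_sub_left, inner_smul_left, sum_inner]
    simp only [real_inner_eq_re, cplxL_apply]
    simp
  set A := 2 * Real.pi * bernsteinConst * √r ^ 5 with hA
  have hA0 : 0 ≤ A := by positivity
  have hY0 : 0 ≤ Y := Real.sqrt_nonneg _
  have bnd : ∀ {v : Fin 3 → L2} {b : L2} {b' : Fin 3 → L2} (k : Fin 3),
      (∑ l, ∂_{e l} (toDist (v l)) = 0) → (∀ l, EssBdd (v l)) →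
      HasWeakGradient (toDist b) b' → EssBdd b →
      |(⟪cplx (transport v b'), w k⟫_ℂ).re| ≤ A * Y * ((∑ l, ‖v l‖) * ‖b‖) := by
    intro v b b' k g1 g2 g3 g4
    refine (abs_re_inner_transport_lowPass_le g1 g2 g3 g4 hr _).trans ?_
    have : 0 ≤ ∑ l, ‖v l‖ := Finset.sum_nonneg fun _ _ => norm_nonneg _
    have := hwY k
    gcongr
  have e2 : ∀ k, (⟪cplx (ut k), w k⟫_ℂ).re ≤ A * Y * ((∑ l, ‖u t l‖) * ‖u t k‖)
      - (⟪cplx (Dp k), w k⟫_ℂ).re + ∑ i, A * Y * ((∑ l, ‖F t l i‖) * ‖F t k i‖) := by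
    intro k
    have g1 : μ * (⟪cplx (Lu k), w k⟫_ℂ).re ≤ 0 :=
      mul_nonpos_of_nonneg_of_nonpos hμ.le (re_inner_laplacian_lowPass_nonpos (hLu k) r)
    have g2 := (abs_le.1 (bnd k hdu hu (hDu k) (hu k))).1
    have g3 : ∑ i, (⟪cplx (transport (fun l => F t l i) (DF k i)), w k⟫_ℂ).re
        ≤ ∑ i, A * Y * ((∑ l, ‖F t l i‖) * ‖F t k i‖) :=
      Finset.sum_le_sum fun i _ =>
        (abs_le.1 (bnd k (hdF i) (fun l => hF l i) (hDF k i) (hF k i))).2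
    rw [e1]
    linarith
  have e3 : ∑ k, (⟪cplx (ut k), w k⟫_ℂ).re
      ≤ A * Y * ((∑ l, ‖u t l‖) ^ 2 + ∑ i, (∑ l, ‖F t l i‖) ^ 2) := by
    refine (Finset.sum_le_sum fun k _ => e2 k).trans (le_of_eq ?_)
    rw [Finset.sum_add_distrib, Finset.sum_sub_distrib, hp, Finset.sum_comm]
    simp only [← Finset.mul_sum]
    simp only [sq]
    ring
  have e4 : (∑ l, ‖u t l‖) ^ 2 + ∑ i, (∑ l, ‖F t l i‖) ^ 2 ≤ 3 * energy (u t) (F t) := by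
    rw [energy, Finset.sum_comm (f := fun k j => ‖F t k j‖ ^ 2), mul_add,
      Finset.mul_sum (a := (3 : ℝ)) (f := fun j => ∑ k, ‖F t k j‖ ^ 2)]
    exact add_le_add (sum_sq_le_three_mul _) (Finset.sum_le_sum fun i _ => sum_sq_le_three_mul _)
  simp only [e0, ← Finset.mul_sum]
  calc 2 * ∑ k, (⟪cplx (ut k), w k⟫_ℂ).re ≤ 2 * (A * Y * (3 * energy (u t) (F t))) := by
        gcongr
        exact e3.trans (by gcongr)
    _ = _ := by rw [hA]; ring

/-! ### Differential inequalities -/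

theorem sub_le_sub_of_hasDerivAt_le {f g f' g' : ℝ → ℝ} (hf : ContinuousOn f (Set.Ici 0))
    (hg : ContinuousOn g (Set.Ici 0)) (hf' : ∀ t, 0 < t → HasDerivAt f (f' t) t)
    (hg' : ∀ t, 0 < t → HasDerivAt g (g' t) t) (h : ∀ t, 0 < t → f' t ≤ g' t) {t : ℝ} (ht : 0 ≤ t) :
    f t - f 0 ≤ g t - g 0 := by
  have hm : AntitoneOn (fun s => f s - g s) (Set.Ici 0) := by
    refine antitoneOn_of_deriv_nonpos (convex_Ici 0) (hf.sub hg) ?_ ?_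
    · intro s hs
      rw [interior_Ici] at hs
      exact ((hf' s hs).sub (hg' s hs)).differentiableAt.differentiableWithinAt
    · intro s hs
      rw [interior_Ici] at hs
      have hd : deriv (fun s => f s - g s) s = f' s - g' s := ((hf' s hs).sub (hg' s hs)).deriv
      rw [hd]
      linarith [h s hs]
  have := hm (Set.mem_Ici.2 le_rfl) (Set.mem_Ici.2 ht) ht
  simp only at this
  linarith

/-- If `y' ≤ 2 b φ √y`, then `√y` grows at rate at most `b φ`. -/
theorem sqrt_le_of_hasDerivAt_le {y y' Φ φ : ℝ → ℝ} {b : ℝ} (hb : 0 ≤ b)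
    (hy : ContinuousOn y (Set.Ici 0)) (hy0 : ∀ t, 0 ≤ y t)
    (hy' : ∀ t, 0 < t → HasDerivAt y (y' t) t)
    (h : ∀ t, 0 < t → y' t ≤ 2 * (b * φ t) * √(y t))
    (hφ : ∀ t, 0 < t → 0 ≤ φ t) (hΦ : ContinuousOn Φ (Set.Ici 0))
    (hΦ' : ∀ t, 0 < t → HasDerivAt Φ (φ t) t) {t : ℝ} (ht : 0 ≤ t) :
    √(y t) ≤ √(y 0) + b * (Φ t - Φ 0) := by
  refine le_of_forall_pos_le_add fun δ hδ => ?_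
  -- The square root is not differentiable where `y` vanishes, so `y` is replaced by `y + δ²`.
  have hp : ∀ s, 0 < y s + δ ^ 2 := fun s => by have := hy0 s; positivity
  have key := sub_le_sub_of_hasDerivAt_le (f := fun s => √(y s + δ ^ 2)) (g := fun s => b * Φ s)
    (f' := fun s => y' s / (2 * √(y s + δ ^ 2))) (g' := fun s => b * φ s)
    ((hy.add continuousOn_const).sqrt) (continuousOn_const.mul hΦ)
    (fun s hs => ((hy' s hs).add_const (δ ^ 2)).sqrt (hp s).ne')
    (fun s hs => (hΦ' s hs).const_mul b)
    (fun s hs => by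
      have h1 : √(y s) ≤ √(y s + δ ^ 2) := Real.sqrt_le_sqrt (by nlinarith)
      have h2 : 0 < √(y s + δ ^ 2) := Real.sqrt_pos.2 (hp s)
      rw [div_le_iff₀ (by positivity)]
      have h3 : 0 ≤ b * φ s := mul_nonneg hb (hφ s hs)
      nlinarith [h s hs, mul_le_mul_of_nonneg_left h1 h3]) ht
  have h1 : √(y t) ≤ √(y t + δ ^ 2) := Real.sqrt_le_sqrt (by nlinarith)
  have h2 : √(y 0 + δ ^ 2) ≤ √(y 0) + δ := by
    rw [Real.sqrt_le_left (by positivity)]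
    nlinarith [Real.sq_sqrt (hy0 0), Real.sqrt_nonneg (y 0)]
  linarith

theorem hasDerivAt_sqrt_add {T t : ℝ} (h : 0 < t + T) :
    HasDerivAt (fun s => √(s + T)) (1 / (2 * √(t + T))) t := by
  simpa using ((hasDerivAt_id t).add_const T).sqrt h.ne'

theorem rpow_neg_three_halves {x : ℝ} (hx : 0 ≤ x) : x ^ (-(3 / 2) : ℝ) = 1 / √x ^ 3 := by
  rw [Real.rpow_neg hx, Real.sqrt_eq_rpow, ← Real.rpow_mul_natCast hx, one_div]
  norm_num

theorem sq_mul_le_of_sqrt_le {A B k q X y : ℝ} (hk : 0 ≤ k) (hq : 0 < q) (hy : 0 ≤ y)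
    (h : √y ≤ A * √(k / q) ^ 3 + B * √(k / q) ^ 5 * X) :
    q ^ 2 * y ≤ 2 * A ^ 2 * k ^ 3 / q + 2 * B ^ 2 * k ^ 5 * X ^ 2 / q ^ 3 := by
  have hr : √(k / q) ^ 2 = k / q := Real.sq_sqrt (by positivity)
  have h1 := (pow_le_pow_left₀ (Real.sqrt_nonneg _) h 2).trans add_sq_le
  rw [Real.sq_sqrt hy] at h1
  have h4 : (A * √(k / q) ^ 3) ^ 2 = A ^ 2 * (k / q) ^ 3 := by
    calc (A * √(k / q) ^ 3) ^ 2 = A ^ 2 * (√(k / q) ^ 2) ^ 3 := by ring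
      _ = _ := by rw [hr]
  have h5 : (B * √(k / q) ^ 5 * X) ^ 2 = B ^ 2 * (k / q) ^ 5 * X ^ 2 := by
    calc (B * √(k / q) ^ 5 * X) ^ 2 = B ^ 2 * (√(k / q) ^ 2) ^ 5 * X ^ 2 := by ring
      _ = _ := by rw [hr]
  rw [h4, h5] at h1
  calc q ^ 2 * y ≤ q ^ 2 * (2 * (A ^ 2 * (k / q) ^ 3 + B ^ 2 * (k / q) ^ 5 * X ^ 2)) := by gcongr
    _ = _ := by field_simp

/-- The choice `κ r² = 2 / s` of the splitting radius turns the energy inequality into an inequality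
for the derivative of `s² E`. -/
theorem weighted_rate_le {κ ν r s E' E U y : ℝ} (hs : 0 < s) (hr : κ * r ^ 2 = 2 / s)
    (hν : 2 / s ≤ 2 * ν) (hUE : U ≤ E)
    (h : E' ≤ -(κ * r ^ 2 * (U - y)) - 2 * ν * (E - U)) :
    2 * s * E + s ^ 2 * E' ≤ 2 * (s * y) := by
  rw [hr] at h
  have h4 : 2 / s * (E - U) ≤ 2 * ν * (E - U) := mul_le_mul_of_nonneg_right hν (by linarith)
  have h5 : E' ≤ 2 / s * (y - E) := by linarith
  have h6 := mul_le_mul_of_nonneg_left h5 (by positivity : 0 ≤ s ^ 2)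
  have h7 : s ^ 2 * (2 / s * (y - E)) = 2 * (s * y) - 2 * s * E := by
    field_simp
  linarith

/-- The Fourier splitting argument. Here `E` is the energy, `U` the part of it that is damped by
viscosity only, and `y r` the part of `U` at frequencies below `r`. At time `t` the splitting radius
is a multiple of `(t + T)^(-1/2)`. A first pass with `E` merely bounded gives the decay rate
`(t + T)^(-1/2)`; with that rate inserted into the bound for the low frequencies a second pass gives
`(t + T)^(-3/2)`. -/
theorem fourier_splitting {κ ν : ℝ} (hκ : 0 < κ) (hν : 0 < ν) {A B E₀ : ℝ} (hE₀ : 0 ≤ E₀) :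
    ∃ C : ℝ, 0 < C ∧ ∀ (E E' U : ℝ → ℝ) (y : ℝ → ℝ → ℝ), ContinuousOn E (Set.Ici 0) → E 0 = E₀ →
      (∀ t, U t ≤ E t) → (∀ r t, 0 ≤ y r t) →
      (∀ t, 0 < t → HasDerivAt E (E' t) t) →
      (∀ t, 0 < t → ∀ r, 0 ≤ r → E' t ≤ -(κ * r ^ 2 * (U t - y r t)) - 2 * ν * (E t - U t)) →
      (∀ Φ φ : ℝ → ℝ, ContinuousOn Φ (Set.Ici 0) → (∀ t, 0 < t → HasDerivAt Φ (φ t) t) →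
        (∀ t, 0 < t → E t ≤ φ t) → ∀ r, 0 ≤ r → ∀ t, 0 ≤ t →
          √(y r t) ≤ A * √r ^ 3 + B * √r ^ 5 * (Φ t - Φ 0)) →
      ∀ t, 0 ≤ t → E t ≤ C * (t + 1) ^ (-(3 / 2) : ℝ) := by
  -- The shift `T` makes `κ r² = 2 / (t + T)` at most `2 ν`, so that the damping of `E - U` is
  -- strong enough for all `t`.
  set T : ℝ := max 1 (1 / ν) with hT
  have hT1 : 1 ≤ T := le_max_left _ _
  have hTν : 1 / ν ≤ T := le_max_right _ _
  set k : ℝ := √(2 / κ) with hk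
  have hk0 : 0 ≤ k := Real.sqrt_nonneg _
  have hk2 : κ * k ^ 2 = 2 := by
    rw [hk, Real.sq_sqrt (by positivity)]; field_simp
  set a : ℝ := 2 * A ^ 2 * k ^ 3 with ha
  set b : ℝ := 2 * B ^ 2 * k ^ 5 with hb
  have ha0 : 0 ≤ a := by positivity
  have hb0 : 0 ≤ b := by positivity
  set c₁ : ℝ := a + b * E₀ ^ 2 with hc₁
  set c₂ : ℝ := T ^ 2 * E₀ + 4 / 3 * c₁ with hc₂
  set c₃ : ℝ := a + b * (2 * c₂) ^ 2 with hc₃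
  set c₄ : ℝ := T ^ 2 * E₀ + 4 * c₃ with hc₄
  have hc₁0 : 0 ≤ c₁ := by positivity
  have hc₂0 : 0 ≤ c₂ := by positivity
  have hc₃0 : 0 ≤ c₃ := by positivity
  have hc₄0 : 0 ≤ c₄ := by positivity
  clear_value c₄ c₃ c₂ c₁ b a k T
  refine ⟨c₄ + 1, by positivity, ?_⟩
  intro E E' U y hEc hE0 hUE hyn hE' hdiss hlow
  have hs1 : ∀ t, 0 ≤ t → 1 ≤ √(t + T) := fun t ht => by
    rw [Real.one_le_sqrt]; linarith
  have hsq : ∀ t, 0 ≤ t → √(t + T) ^ 2 = t + T := fun t ht => Real.sq_sqrt (by linarith)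
  have hEbd : ∀ t, 0 ≤ t → E t ≤ E₀ := by
    intro t ht
    have := sub_le_sub_of_hasDerivAt_le (g := fun _ => 0) (g' := fun _ => 0) hEc continuousOn_const
      hE' (fun s _ => hasDerivAt_const s 0) (fun s hs => by
        have h1 := hdiss s hs 0 le_rfl
        have h2 : 0 ≤ 2 * ν * (E s - U s) := mul_nonneg (by positivity) (by linarith [hUE s])
        simp at h1
        linarith) ht
    simp only [sub_self] at this
    linarith
  -- The splitting radius at time `t` is `k / √(t + T)`.
  have hweight : ∀ t, 0 < t → 2 * (t + T) * E t + (t + T) ^ 2 * E' t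
      ≤ 2 * ((t + T) * y (k / √(t + T)) t) := by
    intro t ht
    have hs : 0 < t + T := by linarith
    refine weighted_rate_le hs ?_ ?_ (hUE t) (hdiss t ht (k / √(t + T)) (by positivity))
    · rw [div_pow, hsq t ht.le, ← mul_div_assoc, hk2]
    · rw [div_le_iff₀ hs]
      have : 1 ≤ T * ν := by rwa [div_le_iff₀ hν] at hTν
      nlinarith
  have hlow' : ∀ t, 0 < t → ∀ X : ℝ, √(y (k / √(t + T)) t)
        ≤ A * √(k / √(t + T)) ^ 3 + B * √(k / √(t + T)) ^ 5 * X →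
      (t + T) * y (k / √(t + T)) t ≤ a / √(t + T) + b * X ^ 2 / √(t + T) ^ 3 := by
    intro t ht X hX
    have h := sq_mul_le_of_sqrt_le hk0 (zero_lt_one.trans_le (hs1 t ht.le)) (hyn _ _) hX
    rwa [hsq t ht.le, ← ha, ← hb] at h
  have hwc : ContinuousOn (fun t => (t + T) ^ 2 * E t) (Set.Ici 0) :=
    ContinuousOn.mul (by fun_prop) hEc
  have hwd : ∀ t, 0 < t → HasDerivAt (fun t => (t + T) ^ 2 * E t)
      (2 * (t + T) * E t + (t + T) ^ 2 * E' t) t := by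
    intro t ht
    have h1 : HasDerivAt (fun t : ℝ => (t + T) ^ 2) (2 * (t + T)) t := by
      simpa using ((hasDerivAt_id t).add_const T).fun_pow 2
    exact h1.mul (hE' t ht)
  -- First pass: the energy is bounded.
  have hpass₁ : ∀ t, 0 ≤ t → E t ≤ c₂ / √(t + T) := by
    intro t ht
    have key := sub_le_sub_of_hasDerivAt_le hwc (g := fun t => 4 / 3 * c₁ * √(t + T) ^ 3)
      (g' := fun t => 2 * c₁ * √(t + T)) (by fun_prop) hwd (fun s hs => by
        have hq1 := hs1 s hs.le
        have h1 := ((hasDerivAt_sqrt_add (T := T) (by linarith : 0 < s + T)).pow 3).const_mul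
          (4 / 3 * c₁)
        refine h1.congr_deriv ?_
        push_cast
        field_simp
        ring) (fun s hs => by
        refine (hweight s hs).trans ?_
        have h1 := hlow (fun s => E₀ * s) (fun _ => E₀) (by fun_prop)
          (fun s _ => by simpa using (hasDerivAt_id s).const_mul E₀) (fun s hs => hEbd s hs.le)
          (k / √(s + T)) (by positivity) s hs.le
        have h2 := hlow' s hs _ h1
        have hq1 := hs1 s hs.le
        have hq2 := hsq s hs.le
        set q := √(s + T) with hq
        have h3 : a / q ≤ a * q := by
          rw [div_le_iff₀ (by positivity)]; nlinarith
        have h4 : b * (E₀ * s - E₀ * 0) ^ 2 / q ^ 3 ≤ b * E₀ ^ 2 * q := by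
          rw [div_le_iff₀ (by positivity)]
          have h5 : s ^ 2 ≤ (q ^ 2) ^ 2 := pow_le_pow_left₀ hs.le (by linarith) 2
          have h6 := mul_le_mul_of_nonneg_left h5 (by positivity : 0 ≤ b * E₀ ^ 2)
          calc b * (E₀ * s - E₀ * 0) ^ 2 = b * E₀ ^ 2 * s ^ 2 := by ring
            _ ≤ _ := h6
            _ = _ := by ring
        rw [hc₁]
        linarith) ht
    have hq1 := hs1 t ht
    have hq2 := hsq t ht
    have hT0 : 0 ≤ 4 / 3 * c₁ * √(0 + T) ^ 3 := by positivity
    simp only [zero_add, hE0] at key hT0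
    set q := √(t + T) with hq
    have h1 : T ^ 2 * E₀ ≤ T ^ 2 * E₀ * q ^ 3 :=
      le_mul_of_one_le_right (by positivity) (one_le_pow₀ hq1)
    rw [le_div_iff₀ (by positivity)]
    refine le_of_mul_le_mul_right ?_ (by positivity : 0 < q ^ 3)
    calc E t * q * q ^ 3 = (t + T) ^ 2 * E t := by rw [← hq2]; ring
      _ ≤ c₂ * q ^ 3 := by rw [hc₂]; linarith
  -- Second pass: the energy decays like `(t + T)^(-1/2)`.
  have hpass₂ : ∀ t, 0 ≤ t → E t ≤ c₄ / √(t + T) ^ 3 := by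
    intro t ht
    have key := sub_le_sub_of_hasDerivAt_le hwc (g := fun t => 4 * c₃ * √(t + T))
      (g' := fun t => 2 * c₃ / √(t + T)) (by fun_prop) hwd (fun s hs => by
        have hq1 := hs1 s hs.le
        have h1 := (hasDerivAt_sqrt_add (T := T) (by linarith : 0 < s + T)).const_mul (4 * c₃)
        refine h1.congr_deriv ?_
        field_simp
        ring) (fun s hs => by
        refine (hweight s hs).trans ?_
        have h1 := hlow (fun s => 2 * c₂ * √(s + T)) (fun s => c₂ / √(s + T)) (by fun_prop)
          (fun s hs => by
            have hq1 := hs1 s hs.le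
            have h1 := (hasDerivAt_sqrt_add (T := T) (by linarith : 0 < s + T)).const_mul (2 * c₂)
            refine h1.congr_deriv ?_
            field_simp) (fun s hs => hpass₁ s hs.le)
          (k / √(s + T)) (by positivity) s hs.le
        have h2 := hlow' s hs _ h1
        have hq1 := hs1 s hs.le
        have h0 : √(0 + T) ≤ √(s + T) := Real.sqrt_le_sqrt (by linarith)
        have h00 := Real.sqrt_nonneg (0 + T)
        set q := √(s + T) with hq
        set q₀ := √(0 + T) with hq₀
        have h4 : b * (2 * c₂ * q - 2 * c₂ * q₀) ^ 2 / q ^ 3 ≤ b * (2 * c₂) ^ 2 / q := by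
          rw [div_le_div_iff₀ (by positivity) (by positivity)]
          have h5 : (q - q₀) ^ 2 ≤ q ^ 2 := pow_le_pow_left₀ (by linarith) (by linarith) 2
          have h6 := mul_le_mul_of_nonneg_left h5 (by positivity : 0 ≤ b * (2 * c₂) ^ 2 * q)
          calc b * (2 * c₂ * q - 2 * c₂ * q₀) ^ 2 * q
              = b * (2 * c₂) ^ 2 * q * (q - q₀) ^ 2 := by ring
            _ ≤ _ := h6
            _ = _ := by ring
        have h7 : 2 * c₃ / q = 2 * (a / q + b * (2 * c₂) ^ 2 / q) := by
          rw [hc₃]; ring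
        rw [h7]
        linarith) ht
    have hq1 := hs1 t ht
    have hq2 := hsq t ht
    have hT0 : 0 ≤ 4 * c₃ * √(0 + T) := by positivity
    simp only [zero_add, hE0] at key hT0
    set q := √(t + T) with hq
    have h1 : T ^ 2 * E₀ ≤ T ^ 2 * E₀ * q := le_mul_of_one_le_right (by positivity) hq1
    rw [le_div_iff₀ (by positivity)]
    refine le_of_mul_le_mul_right ?_ (by positivity : 0 < q)
    calc E t * q ^ 3 * q = (t + T) ^ 2 * E t := by rw [← hq2]; ring
      _ ≤ c₄ * q := by rw [hc₄]; linarith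
  intro t ht
  have h2 : √(t + 1) ≤ √(t + T) := Real.sqrt_le_sqrt (by linarith)
  have h3 : 0 < √(t + 1) := Real.sqrt_pos.2 (by positivity)
  calc E t ≤ c₄ / √(t + T) ^ 3 := hpass₂ t ht
    _ ≤ (c₄ + 1) / √(t + 1) ^ 3 := by gcongr; linarith
    _ = _ := by rw [rpow_neg_three_halves (by positivity)]; ring

/-! ### Global strong solutions -/

section

variable {m : ℕ} {μ ν : ℝ} {u₀ : Fin 3 → L2} {F₀ : Fin 3 → Fin 3 → L2} {u : ℝ → Fin 3 → L2}
  {F : ℝ → Fin 3 → Fin 3 → L2}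

theorem IsGlobalSolution.continuousOn_energy (h : IsGlobalSolution m μ ν u₀ F₀ u F) :
    ContinuousOn (fun t => energy (u t) (F t)) (Set.Ici 0) := by
  refine ContinuousOn.add (continuousOn_finsetSum _ fun k _ => ?_)
    (continuousOn_finsetSum _ fun k _ => continuousOn_finsetSum _ fun j _ => ?_)
  · exact ((h.continuous_u k).continuousOn m.cast_nonneg).norm.pow 2
  · exact ((h.continuous_F k j).continuousOn m.cast_nonneg).norm.pow 2

theorem IsGlobalSolution.continuousOn_lowEnergy (h : IsGlobalSolution m μ ν u₀ F₀ u F) (r : ℝ) :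
    ContinuousOn (fun t => lowEnergy r (u t)) (Set.Ici 0) := by
  refine continuousOn_finsetSum _ fun k _ => ContinuousOn.pow (ContinuousOn.norm ?_) 2
  exact (((lowPass r).restrictScalars ℝ) ∘L cplxL).continuous.comp_continuousOn
    ((h.continuous_u k).continuousOn m.cast_nonneg)

theorem lowEnergy_nonneg (r : ℝ) (u : Fin 3 → L2) : 0 ≤ lowEnergy r u :=
  Finset.sum_nonneg fun _ _ => by positivity

theorem energy_nonneg (u : Fin 3 → L2) (F : Fin 3 → Fin 3 → L2) : 0 ≤ energy u F := by
  unfold energy; positivity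

/-- The growth of the low frequencies up to time `t`, given a bound `φ` for the energy with
primitive `Φ`. -/
theorem IsGlobalSolution.sqrt_lowEnergy_le (hm : 3 ≤ m) (hμ : 0 < μ)
    (h : IsGlobalSolution m μ ν u₀ F₀ u F) {Φ φ : ℝ → ℝ} (hΦ : ContinuousOn Φ (Set.Ici 0))
    (hΦ' : ∀ t, 0 < t → HasDerivAt Φ (φ t) t) (hφ : ∀ t, 0 < t → energy (u t) (F t) ≤ φ t)
    {r : ℝ} (hr : 0 ≤ r) {t : ℝ} (ht : 0 ≤ t) :
    √(lowEnergy r (u t)) ≤ √(lowEnergy r u₀)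
      + 6 * Real.pi * bernsteinConst * √r ^ 5 * (Φ t - Φ 0) := by
  have hc : 0 ≤ bernsteinConst := Real.sqrt_nonneg _
  have hD : ∀ s, ∃ D, 0 < s → HasDerivAt (fun s => lowEnergy r (u s)) D s ∧
      D ≤ 2 * (6 * Real.pi * bernsteinConst * √r ^ 5 * φ s) * √(lowEnergy r (u s)) := by
    intro s
    rcases le_or_gt s 0 with hs | hs
    · exact ⟨0, fun h0 => absurd h0 hs.not_gt⟩
    · obtain ⟨D, h1, h2⟩ := (h.solves s hs).lowEnergy_hasDerivAt hμ
        (fun k => ((h.continuous_u k).memH hs.le).essBdd hm)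
        (fun k j => ((h.continuous_F k j).memH hs.le).essBdd hm) (h.div_u s hs.le)
        (h.div_F s hs.le) hr
      refine ⟨D, fun _ => ⟨h1, h2.trans ?_⟩⟩
      have := hφ s hs
      gcongr
  choose D hD using hD
  have := sqrt_le_of_hasDerivAt_le (by positivity) (h.continuousOn_lowEnergy r)
    (fun s => lowEnergy_nonneg r (u s)) (fun s hs => (hD s hs).1) (fun s hs => (hD s hs).2)
    (fun s hs => (energy_nonneg _ _).trans (hφ s hs)) hΦ hΦ' ht
  rwa [h.initial_u] at this

theorem sqrt_lowEnergy_le_of_integrable (hu₀ : ∀ k, Integrable (u₀ k)) {r : ℝ} (hr : 0 ≤ r) :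
    √(lowEnergy r u₀) ≤ bernsteinConst * (∑ k, ∫ x, ‖u₀ k x‖) * √r ^ 3 := by
  have hc : 0 ≤ bernsteinConst := Real.sqrt_nonneg _
  have hi : ∀ k, 0 ≤ ∫ x, ‖u₀ k x‖ := fun k => integral_nonneg fun _ => norm_nonneg _
  rw [Real.sqrt_le_left (mul_nonneg (mul_nonneg hc (Finset.sum_nonneg fun k _ => hi k))
    (by positivity))]
  calc lowEnergy r u₀ ≤ ∑ k, (bernsteinConst * √r ^ 3 * ∫ x, ‖u₀ k x‖) ^ 2 :=
        Finset.sum_le_sum fun k _ =>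
          pow_le_pow_left₀ (norm_nonneg _) (norm_lowPass_le_of_integrable hr (hu₀ k)) 2
    _ ≤ (∑ k, bernsteinConst * √r ^ 3 * ∫ x, ‖u₀ k x‖) ^ 2 :=
        Finset.sum_sq_le_sq_sum_of_nonneg fun k _ => mul_nonneg (by positivity) (hi k)
    _ = _ := by rw [← Finset.mul_sum]; ring

end

end Oldroyd

theorem theorem1p2 (m : ℕ) (hm : 3 ≤ m) (μ ν : ℝ) (hμ : 0 < μ) (hν : 0 < ν)
    (u₀ : Fin 3 → Oldroyd.L2) (F₀ : Fin 3 → Fin 3 → Oldroyd.L2)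
    (hu₀ : ∀ k, Oldroyd.MemH m (u₀ k)) (hF₀ : ∀ k j, Oldroyd.MemH m (F₀ k j))
    (hu₀_L1 : ∀ k, MeasureTheory.Integrable (u₀ k) MeasureTheory.volume)
    (hF₀_L1 : ∀ k j, MeasureTheory.Integrable (F₀ k j) MeasureTheory.volume) :
    ∃ C : ℝ, 0 < C ∧
      ∀ (u : ℝ → Fin 3 → Oldroyd.L2) (F : ℝ → Fin 3 → Fin 3 → Oldroyd.L2),
        Oldroyd.IsGlobalSolution m μ ν u₀ F₀ u F →
        ∀ t : ℝ, 0 ≤ t →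
          (∑ k, ‖u t k‖ ^ 2) + (∑ k, ∑ j, ‖F t k j‖ ^ 2) ≤ C * (t + 1) ^ (-(3 / 2) : ℝ) := by
  obtain ⟨C, hC, hdecay⟩ := Oldroyd.fourier_splitting (κ := 2 * μ * (2 * Real.pi) ^ 2)
    (by positivity) hν (A := Oldroyd.bernsteinConst * ∑ k, ∫ x, ‖u₀ k x‖)
    (B := 6 * Real.pi * Oldroyd.bernsteinConst) (Oldroyd.energy_nonneg u₀ F₀)
  refine ⟨C, hC, fun u F h => ?_⟩
  have hD : ∀ t, ∃ D, 0 < t → HasDerivAt (fun s => Oldroyd.energy (u s) (F s)) D t ∧ ∀ r, 0 ≤ r →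
      D ≤ -(2 * μ * (2 * Real.pi * r) ^ 2 * ((∑ k, ‖u t k‖ ^ 2) - Oldroyd.lowEnergy r (u t)))
        - 2 * ν * ∑ k, ∑ j, ‖F t k j‖ ^ 2 := by
    intro t
    rcases le_or_gt t 0 with ht | ht
    · exact ⟨0, fun h0 => absurd h0 ht.not_gt⟩
    · obtain ⟨D, hD⟩ := (h.solves t ht).energy_hasDerivAt hμ
        (fun k => ((h.continuous_u k).memH ht.le).essBdd hm)
        (fun k j => ((h.continuous_F k j).memH ht.le).essBdd hm) (h.div_u t ht.le)
        (h.div_F t ht.le)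
      exact ⟨D, fun _ => hD⟩
  choose D hD using hD
  refine hdecay (fun t => Oldroyd.energy (u t) (F t)) D (fun t => ∑ k, ‖u t k‖ ^ 2)
    (fun r t => Oldroyd.lowEnergy r (u t)) h.continuousOn_energy ?_ ?_ ?_ ?_ ?_ ?_
  · simp only [h.initial_u, h.initial_F]
  · exact fun t => le_add_of_nonneg_right (by positivity)
  · exact fun r t => Oldroyd.lowEnergy_nonneg _ _
  · exact fun t ht => (hD t ht).1
  · intro t ht r hr
    refine ((hD t ht).2 r hr).trans (le_of_eq ?_)
    rw [Oldroyd.energy]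
    ring
  · intro Φ φ hΦ hΦ' hφ r hr t ht
    refine (h.sqrt_lowEnergy_le hm hμ hΦ hΦ' hφ hr ht).trans ?_
    gcongr
    exact Oldroyd.sqrt_lowEnergy_le_of_integrable hu₀_L1 hr
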